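/- Let $n\ge 1$, let $\alpha=(\alpha_1,\dots,\alpha_n)$ be a vector of positive real numbers, $|\alpha|=\sum_{i=1}^n\alpha_i$, and let $g\colon(0,\infty)\to(0,\infty)$ be measurable. Let $\mu$ be a multivariate Liouville distribution with these parameters, that is, a probability measure on $(0,\infty)^n$ whose Lebesgue density is $$\rho(x)=Z^{-1}\prod_{i=1}^n x_i^{\alpha_i-1}\,g\Big(\sum_{i=1}^n x_i\Big),\qquad x\in(0,\infty)^n,$$ for a normalization constant $Z\in(0,\infty)$. Let $\mu_S$ be the probability measure on $(0,\infty)$ with density proportional to $s\mapsto s^{|\alpha|-1}g(s)$. Let $w_S\colon(0,\infty)\to(0,\infty)$ be measurable, and suppose that $\mu_S$ satisfies a weighted Poincaré inequality with weight $w_S$: there is a finite constant $C>0$ such that $$\operatorname{Var}_{\mu_S}(h):=\int h^2\,d\mu_S-\Big(\int h\,d\mu_S\Big)^2\le C\int_0^\infty w_S(s)\,h'(s)^2\,d\mu_S(s)$$ for every $h\in L^2(\mu_S)$ that is locally integrable on $(0,\infty)$ with a locally integrable weak derivative $h'$. Let $C_P(\mu_S,w_S)$ be the infimum of all such constants $C$,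 and put $$K=\int_0^\infty\frac{s^2}{w_S(s)}\,d\mu_S(s)\in(0,\infty].$$ Then, writing $s(x)=\sum_{i=1}^n x_i$, $$\operatorname{Var}_\mu(f)\le\max\Big(C_P(\mu_S,w_S),\frac{K}{|\alpha|}\Big)\int_{(0,\infty)^n}\frac{w_S(s(x))}{s(x)}\sum_{i=1}^n x_i\Big(\frac{\partial f}{\partial x_i}(x)\Big)^2\,d\mu(x)$$ for every $f\in L^2(\mu)$ that is locally integrable on $(0,\infty)^n$ and has locally integrable weak partial derivatives $\partial f/\partial x_i$, $i=1,\dots,n$. Here $\operatorname{Var}_\mu(f)=\int f^2\,d\mu-(\int f\,d\mu)^2$, the right-hand sides may be infinite, and $\infty\cdot 0=0$. -/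

import Mathlib

open MeasureTheory Set
open scoped ENNReal ContDiff

noncomputable section

/-- `d` is a weak derivative of `f` in the direction `v` on the open set `Ω`:
both functions are locally integrable on `Ω` for Lebesgue measure, and the integration by parts
formula holds against every smooth test function with compact support in `Ω`. -/
def HasWeakDirDeriv {E : Type*} [NormedAddCommGroup E] [NormedSpace ℝ E] [MeasureSpace E]
    (Ω : Set E) (f : E → ℝ) (v : E) (d : E → ℝ) : Prop :=
  LocallyIntegrableOn f Ω volume ∧ LocallyIntegrableOn d Ω volume ∧
    ∀ φ : E → ℝ, ContDiff ℝ ∞ φ → HasCompactSupport φ → tsupport φ ⊆ Ω →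
      ∫ x in Ω, f x * fderiv ℝ φ x v = - ∫ x in Ω, d x * φ x

/-- The measure on `Ω` with Lebesgue density proportional to `ρ` (on `Ω`), normalized to have
total mass one. -/
def lawPropTo {E : Type*} [MeasureSpace E] (Ω : Set E) (ρ : E → ℝ) : Measure E :=
  (((volume : Measure E).restrict Ω).withDensity (fun x => ENNReal.ofReal (ρ x)) univ)⁻¹ •
    ((volume : Measure E).restrict Ω).withDensity (fun x => ENNReal.ofReal (ρ x))

/-- The open positive orthant `(0,∞)^n`. -/
def posOrthant (n : ℕ) : Set (Fin n → ℝ) := {x | ∀ i, 0 < x i}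

/-- The multivariate Liouville law on `(0,∞)^n`, with density proportional to
`∏ x_i^(α_i - 1) * g (∑ x_i)`. -/
def liouvilleLaw {n : ℕ} (α : Fin n → ℝ) (g : ℝ → ℝ) : Measure (Fin n → ℝ) :=
  lawPropTo (posOrthant n) (fun x => (∏ i, x i ^ (α i - 1)) * g (∑ i, x i))

/-- The radial law on `(0,∞)`, with density proportional to `s^(|α| - 1) * g s`. -/
def radialLaw {n : ℕ} (α : Fin n → ℝ) (g : ℝ → ℝ) : Measure ℝ :=
  lawPropTo (Ioi 0) (fun s => s ^ ((∑ i, α i) - 1) * g s)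

/-- `ν`, a measure on `(0,∞)`, satisfies the weighted Poincaré inequality with weight `w` and
finite constant `C > 0`. The inequality carries no information when the right-hand side is
infinite. -/
def WeightedPoincare (ν : Measure ℝ) (w : ℝ → ℝ) (C : ℝ) : Prop :=
  0 < C ∧ ∀ f d : ℝ → ℝ, MemLp f 2 ν → HasWeakDirDeriv (Ioi 0) f 1 d →
    ENNReal.ofReal ((∫ s, f s ^ 2 ∂ν) - (∫ s, f s ∂ν) ^ 2) ≤
      ENNReal.ofReal C * ∫⁻ s, ENNReal.ofReal (w s * d s ^ 2) ∂ν

/-- The optimal constant `C_P(ν, w)`. -/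
def poincareConst (ν : Measure ℝ) (w : ℝ → ℝ) : ℝ := sInf {C : ℝ | WeightedPoincare ν w C}

end

/-! ### Variance on probability spaces and products, with values in `ℝ≥0∞` -/

section Variance

open ProbabilityTheory

/-! The proof works in polar coordinates. If `t` has law `radialLaw α g` and, independently, `x` has
independent Gamma(`α i`) coordinates, then `(t / ∑ x i) • x` has law `liouvilleLaw α g`
(`measurePreserving_polar`). With `h (t, x) = f ((t / ∑ x i) • x)`, the law of total variance bounds
`Var f` by the mean over `x` of the variance in `t`, plus the variance in `x` of the mean over `t`.

The first term is handled ray by ray with the assumed one-dimensional inequality. For the second,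
Cauchy–Schwarz with weights `t ^ 2 / w t` and `w t / t ^ 2` produces `K` and leaves the mean over
`t` of `(w t / t ^ 2) * Var_x h (t, ·)` (`evariance_integral_le`). At fixed `t` this is a variance
under the Dirichlet law of the direction, bounded by `t ^ 2 / |α|` times the tangential energy
(`ae_evariance_polar_le`). Since the numbers `x i / ∑ x j` form a probability vector, the energy `∑
(x i / ∑ x j) * d i ^ 2` is exactly the squared radial derivative (the square of the mean of the `d
i`) plus the tangential energy (their variance). So the two bounds use disjoint parts of the energy,
and the constant is a maximum, not a sum.

The Dirichlet inequality comes from the Gamma inequality `Var u ≤ E [t * u' t ^ 2]`, tensorized by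
Efron–Stein (`evariance_pi_le`). Applied to the 0-homogeneous function `F = h (t, ·)` itself, this
would bring in `E [1 / ∑ x i]` and lose the constant. It is applied instead to `G = (∑ x i) * F`:
the sum is independent of the direction, so all moments factor, and the excess terms cancel to leave
`1 / |α|`.

As `f` is only weakly differentiable, `ae_hasWeakDirDeriv_comp` supplies the chain rule along almost
every ray and almost every curve swept out by moving one coordinate. -/

lemma evariance_eq_ofReal_sub {Ω : Type*} [MeasurableSpace Ω] {ν : Measure Ω}
    [IsProbabilityMeasure ν] {X : Ω → ℝ} (hX : MemLp X 2 ν) :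
    evariance X ν = ENNReal.ofReal ((∫ x, X x ^ 2 ∂ν) - (∫ x, X x ∂ν) ^ 2) := by
  rw [← ofReal_variance hX, variance_eq_sub hX]
  rfl

lemma lintegral_sq_sub_const {Ω : Type*} [MeasurableSpace Ω] {ν : Measure Ω}
    [IsProbabilityMeasure ν] {X : Ω → ℝ} (hX : MemLp X 2 ν) (c : ℝ) :
    ∫⁻ x, ENNReal.ofReal ((X x - c) ^ 2) ∂ν
      = evariance X ν + ENNReal.ofReal ((∫ x, X x ∂ν - c) ^ 2) := by
  have hc : MemLp (fun x => X x - c) 2 ν := hX.sub (memLp_const c)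
  have hi : ∫ x, (X x - c) ∂ν = ∫ x, X x ∂ν - c := by
    rw [integral_sub (hX.integrable one_le_two) (integrable_const c)]; simp
  have hv : variance X ν = ∫ x, (X x - c) ^ 2 ∂ν - (∫ x, X x ∂ν - c) ^ 2 := by
    rw [← variance_sub_const hX.aestronglyMeasurable c, variance_eq_sub hc, hi]
    rfl
  rw [← ofReal_variance hX, ← ENNReal.ofReal_add (variance_nonneg _ _) (sq_nonneg _), hv,
    sub_add_cancel, ofReal_integral_eq_lintegral_ofReal hc.integrable_sq
      (.of_forall fun _ => sq_nonneg _)]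

lemma memLp_two_iff_lintegral {Ω : Type*} [MeasurableSpace Ω] {ν : Measure Ω} {X : Ω → ℝ}
    (hX : AEStronglyMeasurable X ν) :
    MemLp X 2 ν ↔ ∫⁻ x, ENNReal.ofReal (X x ^ 2) ∂ν < ⊤ := by
  have h := eLpNorm_lt_top_iff_lintegral_rpow_enorm_lt_top (f := X) (μ := ν) two_ne_zero
    ENNReal.ofNat_ne_top
  have e : ∀ x, ‖X x‖ₑ ^ (2 : ℝ) = ENNReal.ofReal (X x ^ 2) := fun x => by
    rw [ENNReal.rpow_two, ← enorm_pow, Real.enorm_of_nonneg (sq_nonneg _)]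
  simp only [ENNReal.toReal_ofNat, e] at h
  exact ⟨fun hm => h.1 hm.2, fun hm => ⟨hX, h.2 hm⟩⟩

variable {A B : Type*} [MeasurableSpace A] [MeasurableSpace B]

lemma ae_memLp_two_prodMk_left {a : Measure A} {b : Measure B} [SFinite a] [SFinite b]
    {h : A × B → ℝ} (hm : Measurable h) (h2 : MemLp h 2 (a.prod b)) :
    ∀ᵐ x ∂a, MemLp (fun y => h (x, y)) 2 b := by
  have h3 := (memLp_two_iff_lintegral hm.aestronglyMeasurable).1 h2
  rw [lintegral_prod _ (by fun_prop)] at h3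
  filter_upwards [ae_lt_top (Measurable.lintegral_prod_right' (f := fun z => ENNReal.ofReal (h z ^ 2))
    (by fun_prop)) h3.ne] with x hx
  exact (memLp_two_iff_lintegral (hm.comp measurable_prodMk_left).aestronglyMeasurable).2 hx

lemma ae_memLp_two_prodMk_right {a : Measure A} {b : Measure B} [SFinite a] [SFinite b]
    {h : A × B → ℝ} (hm : Measurable h) (h2 : MemLp h 2 (a.prod b)) :
    ∀ᵐ y ∂b, MemLp (fun x => h (x, y)) 2 a := by
  have h3 := (memLp_two_iff_lintegral hm.aestronglyMeasurable).1 h2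
  rw [lintegral_prod_symm _ (by fun_prop)] at h3
  filter_upwards [ae_lt_top (Measurable.lintegral_prod_left' (f := fun z => ENNReal.ofReal (h z ^ 2))
    (by fun_prop)) h3.ne] with x hx
  exact (memLp_two_iff_lintegral (hm.comp measurable_prodMk_right).aestronglyMeasurable).2 hx

/-- Law of total variance: for fixed `y`, the second moment about the global mean is the variance in
`x` plus the squared deviation of the partial mean. Only this inequality is needed. -/
lemma evariance_prod_le {a : Measure A} {b : Measure B} [IsProbabilityMeasure a]
    [IsProbabilityMeasure b] {h : A × B → ℝ} (hm : Measurable h) (h2 : MemLp h 2 (a.prod b)) :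
    evariance h (a.prod b) ≤ ∫⁻ y, evariance (fun x => h (x, y)) a ∂b
      + evariance (fun y => ∫ x, h (x, y) ∂a) b := by
  have hms : StronglyMeasurable fun y => ∫ x, h (x, y) ∂a :=
    hm.stronglyMeasurable.integral_prod_left'
  rw [evariance_eq_lintegral_ofReal, evariance_eq_lintegral_ofReal,
    integral_prod_symm _ (h2.integrable one_le_two), lintegral_prod_symm _ (by fun_prop),
    ← lintegral_add_right _ (by have := hms.measurable; fun_prop)]
  refine lintegral_mono_ae ?_
  filter_upwards [ae_memLp_two_prodMk_right hm h2] with y hy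
  exact (lintegral_sq_sub_const hy _).le

/-- Weighted Cauchy–Schwarz: `Y ≤ √p * (√q * Y)` as soon as `p * q ≥ 1`. Extended values let `∫ p`
be infinite. -/
lemma sq_lintegral_le_of_one_le_mul {a : Measure A} {p q Y : A → ℝ≥0∞} (hp : Measurable p)
    (hq : Measurable q) (hY : AEMeasurable Y a) (hpq : ∀ᵐ x ∂a, 1 ≤ p x * q x) :
    (∫⁻ x, Y x ∂a) ^ 2 ≤ (∫⁻ x, p x ∂a) * ∫⁻ x, q x * Y x ^ 2 ∂a := by
  have h1 : ∫⁻ x, Y x ∂a ≤ ∫⁻ x, ((fun x => p x ^ (1 / 2 : ℝ)) *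
      fun x => q x ^ (1 / 2 : ℝ) * Y x) x ∂a := by
    refine lintegral_mono_ae ?_
    filter_upwards [hpq] with x hx
    simp only [Pi.mul_apply]
    rw [← mul_assoc, ← ENNReal.mul_rpow_of_nonneg _ _ (by norm_num : (0 : ℝ) ≤ 1 / 2)]
    exact le_mul_of_one_le_left' (ENNReal.one_le_rpow hx (by norm_num))
  have h2 := h1.trans (ENNReal.lintegral_mul_le_Lp_mul_Lq a Real.HolderConjugate.two_two
    (f := fun x => p x ^ (1 / 2 : ℝ)) (g := fun x => q x ^ (1 / 2 : ℝ) * Y x)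
    (by fun_prop) (by fun_prop))
  have e : ∀ z : ℝ≥0∞, (z ^ (1 / 2 : ℝ)) ^ (2 : ℝ) = z := fun z => by
    rw [← ENNReal.rpow_mul]; norm_num
  calc (∫⁻ x, Y x ∂a) ^ 2 = (∫⁻ x, Y x ∂a) ^ (2 : ℝ) := (ENNReal.rpow_two _).symm
    _ ≤ _ := ENNReal.rpow_le_rpow h2 (by norm_num)
    _ = _ := by
      rw [ENNReal.mul_rpow_of_nonneg _ _ (by norm_num : (0 : ℝ) ≤ 2), e, e]
      congr 2 with x
      · rw [e]
      · rw [ENNReal.mul_rpow_of_nonneg _ _ (by norm_num : (0 : ℝ) ≤ 2), e, ENNReal.rpow_two]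

/-- The deviation of the averaged function is the average over `x` of the deviations of its slices.
Weighted Cauchy–Schwarz in `x`, then Tonelli, moves the variance inside. The weights become `t ^ 2 /
w t` and its inverse in the main proof, and `1` in Efron–Stein. -/
lemma evariance_integral_le {a : Measure A} {b : Measure B} [IsProbabilityMeasure a]
    [IsProbabilityMeasure b] {h : A × B → ℝ} (hm : Measurable h) (h1 : Integrable h (a.prod b))
    {p q : A → ℝ≥0∞} (hp : Measurable p) (hq : Measurable q) (hpq : ∀ᵐ x ∂a, 1 ≤ p x * q x) :
    evariance (fun y => ∫ x, h (x, y) ∂a) b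
      ≤ (∫⁻ x, p x ∂a) * ∫⁻ x, q x * evariance (fun y => h (x, y)) b ∂a := by
  have hn : Measurable fun x => ∫ y, h (x, y) ∂b :=
    hm.stronglyMeasurable.integral_prod_right'.measurable
  have hY : Measurable fun z : A × B => q z.1 * ENNReal.ofReal ((h z - ∫ y, h (z.1, y) ∂b) ^ 2) := by
    have : Measurable fun z : A × B => ∫ y, h (z.1, y) ∂b := hn.comp measurable_fst
    fun_prop
  have key : ∀ᵐ y ∂b, ENNReal.ofReal ((∫ x, h (x, y) ∂a - ∫ y, ∫ x, h (x, y) ∂a ∂b) ^ 2) ≤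
      (∫⁻ x, p x ∂a) *
        ∫⁻ x, q x * ENNReal.ofReal ((h (x, y) - ∫ y', h (x, y') ∂b) ^ 2) ∂a := by
    filter_upwards [h1.prod_left_ae] with y hy
    rw [← integral_prod_symm _ h1, integral_prod _ h1, ← integral_sub hy h1.integral_prod_left]
    have e : ∀ z : ℝ, ENNReal.ofReal (z ^ 2) = ‖z‖ₑ ^ 2 := fun z => by
      rw [← enorm_pow, Real.enorm_of_nonneg (sq_nonneg _)]
    simp only [e]
    refine le_trans ?_ (sq_lintegral_le_of_one_le_mul hp hq ?_ hpq)
    · gcongr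
      exact enorm_integral_le_lintegral_enorm _
    · fun_prop
  rw [evariance_eq_lintegral_ofReal]
  refine (lintegral_mono_ae key).trans ?_
  rw [lintegral_const_mul _ (Measurable.lintegral_prod_left' hY), lintegral_lintegral_swap (by
    exact (hY.comp measurable_swap).aemeasurable)]
  gcongr with x
  dsimp only
  rw [lintegral_const_mul _ (by fun_prop), evariance_eq_lintegral_ofReal]

lemma evariance_prod_le_add {a : Measure A} {b : Measure B} [IsProbabilityMeasure a]
    [IsProbabilityMeasure b] {h : A × B → ℝ} (hm : Measurable h) (h2 : MemLp h 2 (a.prod b)) :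
    evariance h (a.prod b) ≤ ∫⁻ y, evariance (fun x => h (x, y)) a ∂b
      + ∫⁻ x, evariance (fun y => h (x, y)) b ∂a := by
  refine (evariance_prod_le hm h2).trans (add_le_add_right ?_ _)
  simpa using evariance_integral_le hm (h2.integrable one_le_two) (p := 1) (q := 1)
    measurable_one measurable_one (by simp)

lemma measurable_evariance_right {b : Measure B} [SFinite b] {h : A × B → ℝ} (hm : Measurable h) :
    Measurable fun x => evariance (fun y => h (x, y)) b := by
  have hn : Measurable fun x => ∫ y, h (x, y) ∂b :=
    hm.stronglyMeasurable.integral_prod_right'.measurable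
  have : Measurable fun z : A × B => ∫ y, h (z.1, y) ∂b := hn.comp measurable_fst
  simp only [evariance_eq_lintegral_ofReal]
  exact Measurable.lintegral_prod_right' (f := fun z : A × B =>
    ENNReal.ofReal ((h z - ∫ y, h (z.1, y) ∂b) ^ 2)) (by fun_prop)

lemma evariance_comp_of_measurePreserving {a : Measure A} {b : Measure B} {φ : A → B}
    (hφ : MeasurePreserving φ a b) {h : B → ℝ} (hm : Measurable h) :
    evariance (fun x => h (φ x)) a = evariance h b := by
  rw [evariance_eq_lintegral_ofReal, evariance_eq_lintegral_ofReal, ← hφ.map_eq,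
    integral_map hφ.measurable.aemeasurable hm.aestronglyMeasurable,
    lintegral_map (by fun_prop) hφ.measurable]

end Variance

/-! ### Product measures and the Efron–Stein inequality -/

section Pi

open ProbabilityTheory

lemma measurePreserving_finCons {n : ℕ} (ν : Fin (n + 1) → Measure ℝ) [∀ i, SigmaFinite (ν i)] :
    MeasurePreserving (fun z : ℝ × (Fin n → ℝ) => (Fin.cons z.1 z.2 : Fin (n + 1) → ℝ))
      ((ν 0).prod (Measure.pi fun i => ν i.succ)) (Measure.pi ν) := by
  have h := (measurePreserving_piFinSuccAbove ν 0).symm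
  convert h using 1
  ext z i
  rw [MeasurableEquiv.piFinSuccAbove_symm_apply]
  simp [Fin.insertNthEquiv]
  rfl

/-- The Efron–Stein inequality. -/
theorem evariance_pi_le {n : ℕ} (ν : Fin n → Measure ℝ) [∀ i, IsProbabilityMeasure (ν i)]
    {H : (Fin n → ℝ) → ℝ} (hm : Measurable H) (h2 : MemLp H 2 (Measure.pi ν)) :
    evariance H (Measure.pi ν) ≤
      ∑ i, ∫⁻ x, evariance (fun t => H (Function.update x i t)) (ν i) ∂(Measure.pi ν) := by
  induction n with
  | zero =>
    have : H = fun _ => H 0 := funext fun x => congrArg H (Subsingleton.elim _ _)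
    rw [this, evariance_eq_lintegral_ofReal]
    simp
  | succ n ih =>
    have hp := measurePreserving_finCons ν
    have hc : Measurable fun z : ℝ × (Fin n → ℝ) => (Fin.cons z.1 z.2 : Fin (n + 1) → ℝ) :=
      hp.measurable
    have hv : ∀ i : Fin (n + 1), Measurable fun x : Fin (n + 1) → ℝ =>
        evariance (fun t => H (Function.update x i t)) (ν i) := fun i =>
      measurable_evariance_right (h := fun z : (Fin (n + 1) → ℝ) × ℝ =>
        H (Function.update z.1 i z.2)) (hm.comp (by fun_prop))
    have hw : ∀ i : Fin (n + 1), Measurable fun z : ℝ × (Fin n → ℝ) =>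
        evariance (fun t => H (Function.update (Fin.cons z.1 z.2) i t)) (ν i) := fun i =>
      (hv i).comp hc
    have hcm : Measurable fun z : ℝ × (Fin n → ℝ) => H (Fin.cons z.1 z.2) := hm.comp hc
    have hc2 : MemLp (fun z : ℝ × (Fin n → ℝ) => H (Fin.cons z.1 z.2)) 2
        ((ν 0).prod (Measure.pi fun i => ν i.succ)) := h2.comp_measurePreserving hp
    rw [← evariance_comp_of_measurePreserving hp hm, Fin.sum_univ_succ]
    -- Coordinate `0` is split off as one factor; on almost every slice the induction hypothesis
    -- handles the others.
    refine (evariance_prod_le_add hcm hc2).trans (add_le_add ?_ ?_)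
    · rw [← hp.lintegral_comp (hv 0), lintegral_prod_symm _ (hw 0).aemeasurable]
      simp
    · have e : ∀ i : Fin n, ∫⁻ x, evariance (fun t => H (Function.update x i.succ t)) (ν i.succ)
          ∂(Measure.pi ν) = ∫⁻ s, ∫⁻ x, evariance (fun t => H (Fin.cons s (Function.update x i t)))
            (ν i.succ) ∂(Measure.pi fun i => ν i.succ) ∂(ν 0) := fun i => by
        rw [← hp.lintegral_comp (hv i.succ), lintegral_prod _ (hw i.succ).aemeasurable]
        simp [Fin.cons_update]
      simp only [e]
      rw [← lintegral_finsetSum]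
      · refine lintegral_mono_ae ?_
        filter_upwards [ae_memLp_two_prodMk_left hcm hc2] with s hs
        exact ih (fun i => ν i.succ) (hcm.comp measurable_prodMk_left) hs
      · intro i _
        refine Measurable.lintegral_prod_right' (f := fun z : ℝ × (Fin n → ℝ) =>
          evariance (fun t => H (Fin.cons z.1 (Function.update z.2 i t))) (ν i.succ)) ?_
        refine measurable_evariance_right (h := fun z : (ℝ × (Fin n → ℝ)) × ℝ =>
          H (Fin.cons z.1.1 (Function.update z.1.2 i z.2))) ?_
        refine hm.comp (hc.comp (f := fun z : (ℝ × (Fin n → ℝ)) × ℝ =>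
          (z.1.1, Function.update z.1.2 i z.2)) ?_)
        fun_prop

/-- Resampling one coordinate independently leaves a product law unchanged. This turns integrals
over the coordinate lines back into integrals over the whole space. -/
lemma measurePreserving_update {n : ℕ} (ν : Fin n → Measure ℝ) [∀ i, IsProbabilityMeasure (ν i)]
    (i : Fin n) : MeasurePreserving (fun z : (Fin n → ℝ) × ℝ => Function.update z.1 i z.2)
      ((Measure.pi ν).prod (ν i)) (Measure.pi ν) := by
  refine ⟨by fun_prop, (Measure.pi_eq fun s hs => ?_).symm⟩
  rw [Measure.map_apply (by fun_prop) (MeasurableSet.univ_pi hs)]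
  have : (fun z : (Fin n → ℝ) × ℝ => Function.update z.1 i z.2) ⁻¹' univ.pi s =
      (univ.pi (Function.update s i univ)) ×ˢ s i := by
    ext z
    simp only [mem_preimage, mem_univ_pi, mem_prod]
    constructor
    · intro h
      refine ⟨fun j => ?_, by simpa using h i⟩
      by_cases hj : j = i
      · subst hj; simp
      · simpa [hj] using h j
    · rintro ⟨h, hi⟩ j
      by_cases hj : j = i
      · subst hj; simpa using hi
      · simpa [hj] using h j
  rw [this, Measure.prod_prod, Measure.pi_pi, ← Finset.prod_erase_mul _ _ (Finset.mem_univ i),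
    ← Finset.prod_erase_mul (a := i) (s := Finset.univ) (f := fun j => ν j (s j)) (h := Finset.mem_univ i)]
  congr 1
  rw [Function.update_self, measure_univ, mul_one]
  exact Finset.prod_congr rfl fun j hj => by simp [Finset.ne_of_mem_erase hj]

lemma lintegral_pi_prod {n : ℕ} (ν : Fin n → Measure ℝ) [∀ i, SigmaFinite (ν i)]
    {f : Fin n → ℝ → ℝ≥0∞} (hf : ∀ i, Measurable (f i)) :
    ∫⁻ x, ∏ i, f i (x i) ∂(Measure.pi ν) = ∏ i, ∫⁻ t, f i t ∂(ν i) := by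
  induction n with
  | zero => simp
  | succ n ih =>
    rw [← (measurePreserving_finCons ν).lintegral_comp (by fun_prop)]
    simp only [Fin.prod_univ_succ, Fin.cons_zero, Fin.cons_succ]
    rw [lintegral_prod_mul (f := f 0) (g := fun x : Fin n → ℝ => ∏ i, f i.succ (x i)) (by fun_prop)
      (Finset.measurable_fun_prod _ fun i _ => (hf i.succ).comp (measurable_pi_apply i)).aemeasurable,
      ih (fun i => ν i.succ) fun i => hf _]

lemma pi_withDensity {n : ℕ} {f : Fin n → ℝ → ℝ≥0∞} (hf : ∀ i, Measurable (f i))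
    [∀ i, SigmaFinite ((volume : Measure ℝ).withDensity (f i))] :
    Measure.pi (fun i => (volume : Measure ℝ).withDensity (f i)) =
      (volume : Measure (Fin n → ℝ)).withDensity fun x => ∏ i, f i (x i) := by
  refine Measure.pi_eq fun s hs => ?_
  rw [withDensity_apply _ (MeasurableSet.univ_pi hs), ← lintegral_indicator (.univ_pi hs)]
  simp only [withDensity_apply _ (hs _)]
  rw [volume_pi]
  have := lintegral_pi_prod (fun _ : Fin n => (volume : Measure ℝ))
    (f := fun i => (s i).indicator (f i)) fun i => (hf i).indicator (hs i)
  simp only [lintegral_indicator (hs _)] at this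
  rw [← this]
  congr with x
  classical
  by_cases hx : x ∈ univ.pi s
  · rw [indicator_of_mem hx]
    exact Finset.prod_congr rfl fun i _ => by rw [indicator_of_mem (hx i (mem_univ i))]
  · rw [indicator_of_notMem hx]
    simp only [mem_univ_pi, not_forall] at hx
    obtain ⟨i, hi⟩ := hx
    exact (Finset.prod_eq_zero (Finset.mem_univ i) (by rw [indicator_of_notMem hi])).symm

end Pi

/-! ### Local `L¹` approximation of weakly differentiable functions by smooth ones -/

section Mollification

open Filter Topology Convolution ContinuousLinearMap

/-- A sequence of bump functions whose supports shrink to the origin. -/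
noncomputable def shrinkingBump (E : Type*) [NormedAddCommGroup E] [NormedSpace ℝ E] (k : ℕ) :
    ContDiffBump (0 : E) where
  rIn := 1 / (2 * (k + 1))
  rOut := 1 / (k + 1)
  rIn_pos := by positivity
  rIn_lt_rOut := by
    apply one_div_lt_one_div_of_lt <;> nlinarith [(k.cast_nonneg : (0 : ℝ) ≤ k)]

lemma tendsto_rOut_shrinkingBump {E : Type*} [NormedAddCommGroup E] [NormedSpace ℝ E] :
    Tendsto (fun k => (shrinkingBump E k).rOut) atTop (𝓝 0) :=
  tendsto_one_div_add_atTop_nhds_zero_nat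

variable {E : Type*} [NormedAddCommGroup E] [NormedSpace ℝ E] [FiniteDimensional ℝ E]
  [MeasureSpace E] [BorelSpace E] [(volume : Measure E).IsAddHaarMeasure]

/-- Young's inequality in `L¹`: Tonelli and translation invariance. -/
lemma lintegral_enorm_convolution_le {φ g : E → ℝ} (hφ : Measurable φ)
    (hg : AEMeasurable g) :
    ∫⁻ x, ‖(φ ⋆[lsmul ℝ ℝ, volume] g) x‖ₑ ≤ (∫⁻ x, ‖φ x‖ₑ) * ∫⁻ x, ‖g x‖ₑ := by
  have hgm : AEMeasurable (fun z : E × E => g (z.1 - z.2)) :=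
    hg.comp_quasiMeasurePreserving (quasiMeasurePreserving_sub volume volume)
  calc ∫⁻ x, ‖(φ ⋆[lsmul ℝ ℝ, volume] g) x‖ₑ
      ≤ ∫⁻ x, ∫⁻ t, ‖φ t‖ₑ * ‖g (x - t)‖ₑ := by
        refine lintegral_mono fun x => ?_
        rw [convolution_lsmul]
        refine (enorm_integral_le_lintegral_enorm _).trans (le_of_eq ?_)
        simp [enorm_mul]
    _ = ∫⁻ t, ∫⁻ x, ‖φ t‖ₑ * ‖g (x - t)‖ₑ := by
        refine lintegral_lintegral_swap ?_
        exact (hφ.comp measurable_snd).enorm.aemeasurable.mul hgm.enorm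
    _ = ∫⁻ t, ‖φ t‖ₑ * ∫⁻ x, ‖g x‖ₑ := by
        refine lintegral_congr fun t => ?_
        rw [lintegral_const_mul' _ _ enorm_ne_top, lintegral_sub_right_eq_self (fun x => ‖g x‖ₑ) t]
    _ = _ := lintegral_mul_const _ hφ.enorm

/-- Scheffé–Riesz argument: Fatou applied to the nonnegative functions `‖G k‖ + ‖g‖ - ‖G k - g‖`
shows that almost everywhere convergence without gain of norm is `L¹` convergence. -/
lemma eventually_lintegral_enorm_sub_le {X : Type*} [MeasurableSpace X] {ν : Measure X}
    {g : X → ℝ} {G : ℕ → X → ℝ} (hG : ∀ k, AEMeasurable (G k) ν) (hg : Integrable g ν)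
    (hlim : ∀ᵐ x ∂ν, Tendsto (fun k => G k x) atTop (𝓝 (g x)))
    (hle : ∀ k, ∫⁻ x, ‖G k x‖ₑ ∂ν ≤ ∫⁻ x, ‖g x‖ₑ ∂ν) {ε : ℝ≥0∞} (hε : 0 < ε) :
    ∀ᶠ k in atTop, ∫⁻ x, ‖G k x - g x‖ₑ ∂ν ≤ ε := by
  set N := ∫⁻ x, ‖g x‖ₑ ∂ν with hN
  have hNtop : N ≠ ⊤ := hg.2.ne
  have hgm := hg.aemeasurable
  let F : ℕ → X → ℝ≥0∞ := fun k x => (‖G k x‖ₑ + ‖g x‖ₑ) - ‖G k x - g x‖ₑ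
  have hF : ∀ k, AEMeasurable (F k) ν := fun k =>
    ((hG k).enorm.add hgm.enorm).sub ((hG k).sub hgm).enorm
  have hsum : ∀ k, ∫⁻ x, F k x ∂ν + ∫⁻ x, ‖G k x - g x‖ₑ ∂ν ≤ N + N := fun k => by
    rw [← lintegral_add_left' (hF k)]
    calc ∫⁻ x, F k x + ‖G k x - g x‖ₑ ∂ν = ∫⁻ x, ‖G k x‖ₑ + ‖g x‖ₑ ∂ν :=
          lintegral_congr fun x => tsub_add_cancel_of_le enorm_sub_le
      _ = ∫⁻ x, ‖G k x‖ₑ ∂ν + N := lintegral_add_right' _ hgm.enorm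
      _ ≤ N + N := by gcongr; exact hle k
  have hliminf : N + N ≤ liminf (fun k => ∫⁻ x, F k x ∂ν) atTop := by
    refine le_trans (le_of_eq ?_) (lintegral_liminf_le' hF)
    rw [hN, ← lintegral_add_right' _ hgm.enorm]
    refine lintegral_congr_ae ?_
    filter_upwards [hlim] with x hx
    have h1 : Tendsto (fun k => F k x) atTop (𝓝 ((‖g x‖ₑ + ‖g x‖ₑ) - ‖g x - g x‖ₑ)) :=
      ENNReal.Tendsto.sub ((hx.enorm).add tendsto_const_nhds)
        ((hx.sub tendsto_const_nhds).enorm) (Or.inl (by simp))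
    rw [h1.liminf_eq]
    simp
  -- The strict inequality `N + N - ε < N + N` needs `N ≠ 0`.
  rcases eq_or_ne N 0 with h0 | h0
  · refine Eventually.of_forall fun k => ?_
    have := hsum k
    rw [h0, add_zero] at this
    exact (le_add_self.trans this).trans bot_le
  · have hlt : N + N - ε < liminf (fun k => ∫⁻ x, F k x ∂ν) atTop :=
      (ENNReal.sub_lt_self (by simp [hNtop]) (by simp [h0]) hε.ne').trans_le hliminf
    filter_upwards [eventually_lt_of_lt_liminf hlt] with k hk
    have h2 := hsum k
    have h3 : N + N ≤ ∫⁻ x, F k x ∂ν + ε := tsub_le_iff_right.1 hk.le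
    have h4 : ∫⁻ x, F k x ∂ν ≠ ⊤ :=
      ((le_self_add.trans h2).trans_lt (ENNReal.add_lt_top.2 ⟨hNtop.lt_top, hNtop.lt_top⟩)).ne
    exact (ENNReal.add_le_add_iff_left h4).1 (h2.trans h3)

/-- Convolution with a smooth approximation of the identity. -/
noncomputable def mollify (k : ℕ) (g : E → ℝ) : E → ℝ :=
  (g ⋆[lsmul ℝ ℝ, volume] (shrinkingBump E k).normed volume)

lemma mollify_eq (k : ℕ) (g : E → ℝ) :
    mollify k g = ((shrinkingBump E k).normed volume ⋆[lsmul ℝ ℝ, volume] g) := by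
  ext x
  rw [mollify, convolution_eq_swap, convolution_lsmul]
  simp [mul_comm]

lemma contDiff_mollify (k : ℕ) {g : E → ℝ} (hg : LocallyIntegrable g) :
    ContDiff ℝ ∞ (mollify k g) :=
  (shrinkingBump E k).hasCompactSupport_normed.contDiff_convolution_right _ hg
    (shrinkingBump E k).contDiff_normed

lemma eventually_lintegral_mollify_sub_le {g : E → ℝ} (hg : Integrable g) {ε : ℝ≥0∞}
    (hε : 0 < ε) : ∀ᶠ k in atTop, ∫⁻ x, ‖mollify k g x - g x‖ₑ ≤ ε := by
  refine eventually_lintegral_enorm_sub_le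
    (fun k => (contDiff_mollify k hg.locallyIntegrable).continuous.measurable.aemeasurable) hg ?_ ?_ hε
  · simp only [mollify_eq]
    refine ContDiffBump.ae_convolution_tendsto_right_of_locallyIntegrable
      tendsto_rOut_shrinkingBump (K := 2) (Eventually.of_forall fun k => ?_) hg.locallyIntegrable
    simp only [shrinkingBump]
    apply le_of_eq
    field_simp
  · intro k
    rw [mollify_eq]
    refine (lintegral_enorm_convolution_le
      (shrinkingBump E k).continuous_normed.measurable hg.aemeasurable).trans (le_of_eq ?_)
    have : ∫⁻ x, ‖(shrinkingBump E k).normed volume x‖ₑ = 1 := by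
      rw [← ofReal_integral_norm_eq_lintegral_enorm (shrinkingBump E k).integrable_normed]
      simp [Real.norm_of_nonneg ((shrinkingBump E k).nonneg_normed _),
        (shrinkingBump E k).integral_normed]
    rw [this, one_mul]

/-- The translated bump `t ↦ φ (x - t)` is supported in `K ⊆ Ω`, so it is an admissible test
function, and the cutoff by `K` is invisible to it. Weak differentiability then moves the derivative
from the bump to `f`. -/
lemma fderiv_mollify_indicator {Ω K : Set E} {f d : E → ℝ} {v : E}
    (h : HasWeakDirDeriv Ω f v d) (hΩ : MeasurableSet Ω) (hK : IsCompact K) (hKΩ : K ⊆ Ω) (k : ℕ)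
    {x : E} (hx : Metric.closedBall x (shrinkingBump E k).rOut ⊆ K) :
    fderiv ℝ (mollify k (K.indicator f)) x v = mollify k (K.indicator d) x := by
  set φ := shrinkingBump E k with hφ
  have hKm := hK.measurableSet
  have hloc : ∀ {g : E → ℝ}, LocallyIntegrableOn g Ω → LocallyIntegrable (K.indicator g) :=
    fun hg => ((integrable_indicator_iff hKm).2
      (hg.integrableOn_compact_subset hKΩ hK)).locallyIntegrable
  have hφ1 : ContDiff ℝ 1 (φ.normed volume) := φ.contDiff_normed
  have hφs : HasCompactSupport (φ.normed volume) := φ.hasCompactSupport_normed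
  have hts : tsupport (fun t => φ.normed volume (x - t)) ⊆ Metric.closedBall x φ.rOut := by
    refine closure_minimal (fun t ht => ?_) Metric.isClosed_closedBall
    have : x - t ∈ Metric.ball (0 : E) φ.rOut := by
      rw [← φ.support_normed_eq (μ := volume)]; exact ht
    rw [Metric.mem_closedBall, dist_eq_norm']
    simpa using (mem_ball_zero_iff.1 this).le
  have hzero : ∀ t, t ∉ K → φ.normed volume (x - t) = 0 := fun t ht => by
    by_contra hne
    exact ht (hx (hts (subset_tsupport _ hne)))
  have hfd : ∀ t, fderiv ℝ (fun t => φ.normed volume (x - t)) t v =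
      - fderiv ℝ (φ.normed volume) (x - t) v := fun t => by
    have h1 : HasFDerivAt (φ.normed volume) (fderiv ℝ (φ.normed volume) (x - t)) (x - t) :=
      (hφ1.differentiable one_ne_zero _).hasFDerivAt
    have h2 := h1.comp t ((hasFDerivAt_id t).const_sub x)
    rw [show (fun t => φ.normed volume (x - t)) = φ.normed volume ∘ HSub.hSub x from rfl,
      h2.fderiv]
    simp
  have hdzero : ∀ t, t ∉ K → fderiv ℝ (φ.normed volume) (x - t) v = 0 := fun t ht => by
    have h1 : t ∉ tsupport (fun t => φ.normed volume (x - t)) := fun h => ht (hx (hts h))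
    have h2 := fun h => h1 (tsupport_fderiv_subset ℝ (subset_tsupport _ h))
    have h3 : fderiv ℝ (fun t => φ.normed volume (x - t)) t = 0 := by
      simpa [Function.mem_support] using h2
    have := hfd t
    rw [h3] at this
    simpa using this.symm
  have hw := h.2.2 (fun t => φ.normed volume (x - t))
    (φ.contDiff_normed.comp (contDiff_const.sub contDiff_id))
    ((isCompact_closedBall x _).of_isClosed_subset (isClosed_tsupport _) hts)
    (hts.trans (hx.trans hKΩ))
  have hind : ∀ (g p : E → ℝ), (∀ t, t ∉ K → p t = 0) →
      ∫ t, K.indicator g t * p t = ∫ t in Ω, g t * p t := fun g p hp => by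
    rw [← integral_indicator hΩ]
    congr with t
    by_cases ht : t ∈ K
    · simp [ht, hKΩ ht]
    · by_cases ht' : t ∈ Ω <;> simp [ht, ht', hp t ht]
  rw [mollify, mollify,
    (hφs.hasFDerivAt_convolution_right (lsmul ℝ ℝ) (hloc h.1) hφ1 x).fderiv,
    convolution_precompR_apply (lsmul ℝ ℝ) (hloc h.1) (hφs.fderiv ℝ)
      (hφ1.continuous_fderiv one_ne_zero), convolution_lsmul, convolution_lsmul]
  simp only [smul_eq_mul]
  rw [hind _ _ hdzero, hind _ _ hzero]
  simp only [hfd, mul_neg, integral_neg, neg_inj] at hw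
  exact hw

/-- Functions with weak derivatives are locally approximated, together with these derivatives,
by smooth functions. -/
lemma exists_contDiff_lintegral_sub_le {ι : Type*} [Finite ι] {Ω K : Set E} {f : E → ℝ}
    {v : ι → E} {d : ι → E → ℝ} (h : ∀ i, HasWeakDirDeriv Ω f (v i) (d i))
    (hf : LocallyIntegrableOn f Ω) (hΩ : IsOpen Ω)
    (hK : IsCompact K) (hKΩ : K ⊆ Ω) {ε : ℝ≥0∞} (hε : 0 < ε) :
    ∃ F : E → ℝ, ContDiff ℝ ∞ F ∧ ∫⁻ x in K, ‖F x - f x‖ₑ ≤ ε ∧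
      ∀ i, ∫⁻ x in K, ‖fderiv ℝ F x (v i) - d i x‖ₑ ≤ ε := by
  -- Cutting off on a compact thickening `K'` rather than on `K` leaves room for the bump centred at
  -- any point of `K`.
  obtain ⟨δ, hδ, hδΩ⟩ := hK.exists_cthickening_subset_open hΩ hKΩ
  set K' := Metric.cthickening δ K with hK'
  have hK'c : IsCompact K' := hK.cthickening
  have hKK' : K ⊆ K' := Metric.self_subset_cthickening K
  have hint : ∀ {g : E → ℝ}, LocallyIntegrableOn g Ω → Integrable (K'.indicator g) :=
    fun hg => (integrable_indicator_iff hK'c.measurableSet).2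
      (hg.integrableOn_compact_subset hδΩ hK'c)
  have hev := (eventually_lintegral_mollify_sub_le (hint hf) hε).and
    ((eventually_all.2 fun i => eventually_lintegral_mollify_sub_le (hint (h i).2.1) hε).and
      ((tendsto_rOut_shrinkingBump (E := E)).eventually_lt_const hδ))
  obtain ⟨k, hk1, hk2, hk3⟩ := hev.exists
  have hind : ∀ (G g : E → ℝ), ∫⁻ x in K, ‖G x - g x‖ₑ ≤ ∫⁻ x, ‖G x - K'.indicator g x‖ₑ :=
    fun G g => by
      refine le_trans (le_of_eq ?_) (setLIntegral_le_lintegral K _)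
      refine setLIntegral_congr_fun hK.measurableSet fun x hx => ?_
      simp only [indicator_of_mem (hKK' hx)]
  refine ⟨mollify k (K'.indicator f), contDiff_mollify k (hint hf).locallyIntegrable,
    (hind _ _).trans hk1, fun i => ?_⟩
  refine le_trans (le_of_eq ?_) ((hind _ _).trans (hk2 i))
  refine setLIntegral_congr_fun hK.measurableSet fun x hx => ?_
  rw [fderiv_mollify_indicator (h i) hΩ.measurableSet hK'c hδΩ k]
  exact (Metric.closedBall_subset_closedBall hk3.le).trans
    (Metric.closedBall_subset_cthickening hx δ)

end Mollification

/-! ### Compact exhaustions of the half-line and of the orthant -/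

section Exhaustion

/-- An increasing sequence of compact intervals whose union is `(0,∞)`. -/
def exhIcc (m : ℕ) : Set ℝ := Icc (1 / ((m : ℝ) + 1)) (m + 1)

/-- An increasing sequence of compact boxes whose union is the open orthant. -/
def exhBox (n m : ℕ) : Set (Fin n → ℝ) := univ.pi fun _ => exhIcc m

lemma exhIcc_subset_Ioi (m : ℕ) : exhIcc m ⊆ Ioi 0 := fun _ hx =>
  lt_of_lt_of_le (by positivity) hx.1

lemma isCompact_exhIcc (m : ℕ) : IsCompact (exhIcc m) := isCompact_Icc

lemma isCompact_exhBox (n m : ℕ) : IsCompact (exhBox n m) :=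
  isCompact_univ_pi fun _ => isCompact_exhIcc m

lemma exhBox_subset_posOrthant (n m : ℕ) : exhBox n m ⊆ posOrthant n := fun _ hx i =>
  exhIcc_subset_Ioi m (hx i (mem_univ i))

lemma exhIcc_mono {m k : ℕ} (hmk : m ≤ k) : exhIcc m ⊆ exhIcc k := by
  have : (m : ℝ) ≤ k := by exact_mod_cast hmk
  refine Icc_subset_Icc ?_ (by linarith)
  gcongr

/-- A bound for `φ + φ⁻¹` on `C` keeps `φ` away from both `0` and `∞`. With `φ = id`, every compact
subset of `(0,∞)` lies in some `exhIcc m`. -/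
lemma exists_mem_exhIcc {X : Type*} [TopologicalSpace X] {C : Set X} (hC : IsCompact C)
    {φ : X → ℝ} (hφ : ContinuousOn φ C) (hpos : ∀ x ∈ C, 0 < φ x) :
    ∃ m, ∀ x ∈ C, φ x ∈ exhIcc m := by
  obtain ⟨B, hB⟩ := hC.exists_bound_of_continuousOn
    (hφ.add (hφ.inv₀ fun x hx => (hpos x hx).ne'))
  obtain ⟨m, hm⟩ := exists_nat_ge B
  refine ⟨m, fun x hx => ?_⟩
  have h1 := hpos x hx
  have h2 : 0 < (φ x)⁻¹ := inv_pos.2 h1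
  have h3 : φ x + (φ x)⁻¹ ≤ m := (le_abs_self _).trans ((hB x hx).trans hm)
  refine ⟨?_, by linarith⟩
  rw [one_div, inv_le_comm₀ (by positivity) h1]
  linarith

lemma exists_mem_exhBox {n : ℕ} {X : Type*} [TopologicalSpace X] {C : Set X} (hC : IsCompact C)
    {φ : X → Fin n → ℝ} (hφ : ContinuousOn φ C) (hpos : ∀ x ∈ C, φ x ∈ posOrthant n) :
    ∃ m, ∀ x ∈ C, φ x ∈ exhBox n m := by
  choose m hm using fun i => exists_mem_exhIcc hC (continuousOn_pi.1 hφ i) fun x hx => hpos x hx i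
  exact ⟨Finset.univ.sup m, fun x hx i _ =>
    exhIcc_mono (Finset.le_sup (Finset.mem_univ i)) (hm i x hx)⟩

lemma iUnion_exhIcc : ⋃ m, exhIcc m = Ioi 0 := by
  refine Subset.antisymm (iUnion_subset exhIcc_subset_Ioi) fun x hx => mem_iUnion.2 ?_
  obtain ⟨m, hm⟩ := exists_mem_exhIcc (isCompact_singleton (x := x)) continuousOn_id
    (by simpa using hx)
  exact ⟨m, by simpa using hm⟩

end Exhaustion

/-! ### Fundamental theorem of calculus for weak derivatives on the half-line -/

section WeakDerivLine

open Filter Topology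

/-- The geometric rate makes the integrals summable, so the series of the `u k` converges almost
everywhere. Plain `L¹` convergence would only give this along a subsequence. -/
lemma ae_tendsto_zero_of_lintegral_le {X : Type*} [MeasurableSpace X] {ν : Measure X}
    {u : ℕ → X → ℝ≥0∞} (hu : ∀ k, AEMeasurable (u k) ν)
    {B : ℝ≥0∞} (hB : B ≠ ⊤) (h : ∀ k, ∫⁻ x, u k x ∂ν ≤ B * 2⁻¹ ^ k) :
    ∀ᵐ x ∂ν, Tendsto (fun k => u k x) atTop (𝓝 0) := by
  have h1 : ∫⁻ x, ∑' k, u k x ∂ν ≠ ⊤ := by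
    rw [lintegral_tsum hu]
    refine ((ENNReal.tsum_le_tsum h).trans_lt ?_).ne
    rw [ENNReal.tsum_mul_left, ENNReal.tsum_geometric]
    exact ENNReal.mul_lt_top hB.lt_top (by simp)
  filter_upwards [ae_lt_top' (AEMeasurable.tsum hu) h1] with x hx
  exact ENNReal.tendsto_atTop_zero_of_tsum_ne_top hx.ne

/-- The identity holds for smooth approximations. Their values converge almost everywhere and their
derivatives in `L¹`, so both sides pass to the limit. -/
lemma HasWeakDirDeriv.ae_sub_eq_integral_Icc {h d : ℝ → ℝ} (hd : HasWeakDirDeriv (Ioi 0) h 1 d)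
    {a b : ℝ} (ha : 0 < a) :
    ∀ᵐ x ∂volume.restrict (Icc a b), ∀ᵐ y ∂volume.restrict (Icc a b),
      h y - h x = ∫ t in x..y, d t := by
  have hsub : Icc a b ⊆ Ioi 0 := fun x hx => ha.trans_le hx.1
  have hε : ∀ k : ℕ, (0 : ℝ≥0∞) < 2⁻¹ ^ k := fun k => ENNReal.pow_pos (by simp) k
  choose F hF1 hF2 hF3 using fun k : ℕ => exists_contDiff_lintegral_sub_le (ι := Unit)
    (v := fun _ => (1 : ℝ)) (d := fun _ => d) (fun _ => hd) hd.1 isOpen_Ioi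
    (isCompact_Icc (a := a) (b := b)) hsub (hε k)
  have hhm : AEMeasurable h (volume.restrict (Icc a b)) :=
    (hd.1.integrableOn_compact_subset hsub isCompact_Icc).aemeasurable
  have hdi : IntegrableOn d (Icc a b) := hd.2.1.integrableOn_compact_subset hsub isCompact_Icc
  have hlim : ∀ᵐ x ∂volume.restrict (Icc a b), Tendsto (fun k => F k x) atTop (𝓝 (h x)) := by
    filter_upwards [ae_tendsto_zero_of_lintegral_le
      (fun k => ((hF1 k).continuous.measurable.aemeasurable.sub hhm).enorm)
      ENNReal.one_ne_top (by simpa using hF2)] with x hx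
    rw [tendsto_iff_edist_tendsto_0]
    simpa only [edist_eq_enorm_sub, Pi.sub_apply] using hx
  filter_upwards [hlim, ae_restrict_mem measurableSet_Icc] with x hx hxm
  filter_upwards [hlim, ae_restrict_mem measurableSet_Icc] with y hy hym
  refine tendsto_nhds_unique (hy.sub hx) ?_
  have hF' : ∀ k, F k y - F k x = ∫ t in x..y, fderiv ℝ (F k) t 1 := fun k => by
    have h1 : ContDiff ℝ 1 (F k) := (hF1 k).of_le (by exact_mod_cast le_top)
    rw [← intervalIntegral.integral_deriv_eq_sub
      (fun t _ => h1.differentiable one_ne_zero t)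
      ((h1.continuous_deriv le_rfl).intervalIntegrable _ _)]
    rfl
  simp only [hF']
  have hxy : uIoc x y ⊆ Icc a b := uIoc_subset_uIcc.trans (uIcc_subset_Icc hxm hym)
  rw [tendsto_iff_edist_tendsto_0]
  refine tendsto_of_tendsto_of_tendsto_of_le_of_le tendsto_const_nhds
    (ENNReal.tendsto_pow_atTop_nhds_zero_of_lt_one (by simp : (2⁻¹ : ℝ≥0∞) < 1))
    (fun _ => bot_le) fun k => ?_
  have h1 : ContDiff ℝ 1 (F k) := (hF1 k).of_le (by exact_mod_cast le_top)
  have hc : Continuous fun t => fderiv ℝ (F k) t 1 := h1.continuous_deriv le_rfl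
  have hdx : IntervalIntegrable d volume x y :=
    intervalIntegrable_iff.2 (hdi.mono_set hxy)
  rw [edist_eq_enorm_sub, ← intervalIntegral.integral_sub (hc.intervalIntegrable _ _) hdx]
  refine le_trans ?_ (hF3 k ())
  rw [← ofReal_norm, intervalIntegral.norm_integral_eq_norm_integral_uIoc,
    ofReal_norm]
  exact (enorm_integral_le_lintegral_enorm _).trans (lintegral_mono_set hxy)

lemma HasWeakDirDeriv.ae_sub_eq_integral {h d : ℝ → ℝ} (hd : HasWeakDirDeriv (Ioi 0) h 1 d) :
    ∀ᵐ x ∂volume.restrict (Ioi 0), ∀ᵐ y ∂volume.restrict (Ioi 0),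
      h y - h x = ∫ t in x..y, d t := by
  have hall : ∀ᵐ x ∂volume.restrict (Ioi 0), ∀ m : ℕ, x ∈ exhIcc m →
      ∀ᵐ y ∂volume.restrict (exhIcc m), h y - h x = ∫ t in x..y, d t := by
    refine ae_all_iff.2 fun m => ae_restrict_of_ae ((ae_restrict_iff' measurableSet_Icc).1 ?_)
    exact hd.ae_sub_eq_integral_Icc (by positivity)
  filter_upwards [hall, ae_restrict_mem measurableSet_Ioi] with x hx hxm
  rw [← iUnion_exhIcc] at hxm ⊢
  obtain ⟨m, hm⟩ := mem_iUnion.1 hxm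
  rw [ae_restrict_iUnion_iff]
  intro j
  -- `x` lies in `exhIcc m` and `y` in `exhIcc j`; the larger interval contains both.
  exact ae_restrict_of_ae_restrict_of_subset (exhIcc_mono (le_max_right m j))
    (hx (max m j) (exhIcc_mono (le_max_left _ _) hm))

lemma ofReal_sq_eq_enorm_sq (x : ℝ) : ENNReal.ofReal (x ^ 2) = ‖x‖ₑ ^ 2 := by
  rw [← enorm_pow, Real.enorm_of_nonneg (sq_nonneg _)]

lemma ofReal_sq_le_of_eq_integral {d : ℝ → ℝ} (hdm : Measurable d) {x y z : ℝ} (hxy : x ≤ y)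
    (hz : z = ∫ t in x..y, d t) :
    ENNReal.ofReal (z ^ 2) ≤
      ENNReal.ofReal (y - x) * ∫⁻ t in Ioc x y, ENNReal.ofReal (d t ^ 2) := by
  rw [intervalIntegral.integral_of_le hxy] at hz
  simp only [ofReal_sq_eq_enorm_sq]
  have h1 : ‖z‖ₑ ≤ ∫⁻ t in Ioc x y, ‖d t‖ₑ := hz ▸ enorm_integral_le_lintegral_enorm _
  have h2 := sq_lintegral_le_of_one_le_mul (a := volume.restrict (Ioc x y)) (p := 1) (q := 1)
    (Y := fun t => ‖d t‖ₑ) measurable_one measurable_one (by fun_prop) (by simp)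
  simp only [Pi.one_apply, lintegral_one, Measure.restrict_apply_univ, Real.volume_Ioc,
    one_mul] at h2
  exact (pow_le_pow_left' h1 2).trans h2

end WeakDerivLine

/-! ### Moments and the Stein kernel of the Gamma law -/

section Gamma

open ProbabilityTheory Filter Topology

lemma gammaPDFReal_one_of_pos {a x : ℝ} (hx : 0 < x) :
    gammaPDFReal a 1 x = (Real.Gamma a)⁻¹ * (x ^ (a - 1) * Real.exp (-x)) := by
  rw [gammaPDFReal, if_pos hx.le]
  simp [mul_assoc]

lemma ae_pos_gammaMeasure {a : ℝ} : ∀ᵐ x ∂(gammaMeasure a 1), 0 < x := by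
  rw [gammaMeasure, ae_withDensity_iff
    (show Measurable (gammaPDF a 1) from (measurable_gammaPDFReal a 1).ennreal_ofReal)]
  filter_upwards [Measure.ae_ne volume (0 : ℝ)] with x hx h
  by_contra hn
  exact h (gammaPDF_of_neg (lt_of_le_of_ne (not_lt.1 hn) hx))

lemma lintegral_gammaMeasure {a : ℝ} {F : ℝ → ℝ≥0∞} (hF : Measurable F) :
    ∫⁻ x, F x ∂(gammaMeasure a 1) = ∫⁻ x, gammaPDF a 1 x * F x :=
  lintegral_withDensity_eq_lintegral_mul _ (measurable_gammaPDFReal a 1).ennreal_ofReal hF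

/-- Size-biasing raises the Gamma parameter by one, by `Γ(a + 1) = a Γ(a)`. The first two moments
follow. -/
lemma lintegral_mul_gammaMeasure {a : ℝ} (ha : 0 < a) {F : ℝ → ℝ≥0∞} (hF : Measurable F) :
    ∫⁻ x, ENNReal.ofReal x * F x ∂(gammaMeasure a 1) =
      ENNReal.ofReal a * ∫⁻ x, F x ∂(gammaMeasure (a + 1) 1) := by
  rw [lintegral_gammaMeasure (by fun_prop), lintegral_gammaMeasure hF,
    ← lintegral_const_mul' _ _ ENNReal.ofReal_ne_top]
  refine lintegral_congr_ae ?_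
  filter_upwards [Measure.ae_ne volume (0 : ℝ)] with x hx
  rcases lt_or_gt_of_ne hx with h | h
  · simp [gammaPDF_of_neg h]
  · rw [← mul_assoc, ← mul_assoc, gammaPDF, gammaPDF, ← ENNReal.ofReal_mul' h.le,
      ← ENNReal.ofReal_mul ha.le, gammaPDFReal_one_of_pos h, gammaPDFReal_one_of_pos h,
      Real.Gamma_add_one ha.ne']
    congr 2
    rw [add_sub_cancel_right, show x ^ a = x ^ (a - 1) * x by
      rw [← Real.rpow_add_one h.ne', sub_add_cancel]]
    have := (Real.Gamma_pos_of_pos ha).ne'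
    field_simp

lemma lintegral_id_gammaMeasure {a : ℝ} (ha : 0 < a) :
    ∫⁻ x, ENNReal.ofReal x ∂(gammaMeasure a 1) = ENNReal.ofReal a := by
  have := isProbabilityMeasure_gammaMeasure (show 0 < a + 1 by linarith) one_pos
  simpa using lintegral_mul_gammaMeasure ha (F := 1) measurable_one

lemma lintegral_sq_gammaMeasure {a : ℝ} (ha : 0 < a) :
    ∫⁻ x, ENNReal.ofReal (x ^ 2) ∂(gammaMeasure a 1) = ENNReal.ofReal (a * (a + 1)) := by
  rw [ENNReal.ofReal_mul ha.le, ← lintegral_id_gammaMeasure (show 0 < a + 1 by linarith),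
    ← lintegral_mul_gammaMeasure ha (by fun_prop)]
  refine lintegral_congr_ae ?_
  filter_upwards [ae_pos_gammaMeasure] with x hx
  rw [← ENNReal.ofReal_mul hx.le, sq]

lemma integrable_id_gammaMeasure {a : ℝ} (ha : 0 < a) :
    Integrable (fun x => x) (gammaMeasure a 1) := by
  refine ⟨by fun_prop, ?_⟩
  rw [hasFiniteIntegral_iff_ofReal (ae_pos_gammaMeasure.mono fun x hx => hx.le),
    lintegral_id_gammaMeasure ha]
  simp

lemma integral_id_gammaMeasure {a : ℝ} (ha : 0 < a) : ∫ x, x ∂(gammaMeasure a 1) = a := by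
  rw [integral_eq_lintegral_of_nonneg_ae (ae_pos_gammaMeasure.mono fun x hx => hx.le)
    (by fun_prop), lintegral_id_gammaMeasure ha, ENNReal.toReal_ofReal ha.le]

/-- With `γ` the Gamma density, `-(y γ(y))' = (y - a) γ(y)` and `y γ(y)` vanishes at infinity. This
Stein identity is the source of the weight `t` in the Gamma inequality. -/
lemma integral_Ioi_sub_gammaMeasure {a t : ℝ} (ha : 0 < a) (ht : 0 < t) :
    ∫ y in Ioi t, (y - a) ∂(gammaMeasure a 1) = t * gammaPDFReal a 1 t := by
  have := isProbabilityMeasure_gammaMeasure ha one_pos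
  have hm : Measurable (gammaPDF a 1) := (measurable_gammaPDFReal a 1).ennreal_ofReal
  have hint : IntegrableOn (fun y => y - a) (Ioi t) (gammaMeasure a 1) :=
    ((integrable_id_gammaMeasure ha).sub (integrable_const a)).integrableOn
  have htr : ∀ y, (gammaPDF a 1 y).toReal = gammaPDFReal a 1 y := fun y =>
    ENNReal.toReal_ofReal (gammaPDFReal_nonneg ha one_pos y)
  have hint' : IntegrableOn (fun y => gammaPDFReal a 1 y * (y - a)) (Ioi t) := by
    rw [IntegrableOn, gammaMeasure, restrict_withDensity measurableSet_Ioi,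
      integrable_withDensity_iff_integrable_smul' hm (.of_forall fun _ => ENNReal.ofReal_lt_top)]
      at hint
    simpa only [htr, smul_eq_mul, IntegrableOn] using hint
  rw [gammaMeasure, restrict_withDensity measurableSet_Ioi,
    integral_withDensity_eq_integral_toReal_smul hm (.of_forall fun _ => ENNReal.ofReal_lt_top)]
  simp only [htr, smul_eq_mul]
  have hder : ∀ y ∈ Ici t, HasDerivAt (fun y => -((Real.Gamma a)⁻¹ * (y ^ a * Real.exp (-y))))
      (gammaPDFReal a 1 y * (y - a)) y := fun y hy => by
    have hy0 : 0 < y := ht.trans_le hy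
    have h1 := ((Real.hasDerivAt_rpow_const (p := a) (Or.inl hy0.ne')).mul
      (hasDerivAt_neg y).exp).const_mul (Real.Gamma a)⁻¹ |>.neg
    refine h1.congr_deriv ?_
    rw [gammaPDFReal_one_of_pos hy0]
    have : y ^ a = y ^ (a - 1) * y := by rw [← Real.rpow_add_one hy0.ne', sub_add_cancel]
    rw [this]
    ring
  have hlim : Tendsto (fun y : ℝ => -((Real.Gamma a)⁻¹ * (y ^ a * Real.exp (-y)))) atTop (𝓝 0) := by
    have := tendsto_rpow_mul_exp_neg_mul_atTop_nhds_zero a 1 one_pos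
    simpa using (this.const_mul (Real.Gamma a)⁻¹).neg
  rw [integral_Ioi_of_hasDerivAt_of_tendsto' hder hint' hlim, gammaPDFReal_one_of_pos ht,
    show t ^ a = t ^ (a - 1) * t by rw [← Real.rpow_add_one ht.ne', sub_add_cancel]]
  ring

lemma nullSingletonClass_gammaMeasure {a : ℝ} : NullSingletonClass (gammaMeasure a 1) := by
  unfold gammaMeasure
  infer_instance

/-- With tail mass `q` and tail first moment `M`, the double integral is `(1 - q) * M - (a - M) * q
= M - a * q`, which is the integral of `y - a` over the tail. -/
lemma lintegral_Iio_Ici_gammaMeasure {a t : ℝ} (ha : 0 < a) (ht : 0 < t) :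
    ∫⁻ x in Iio t, ∫⁻ y in Ici t, ENNReal.ofReal (y - x) ∂(gammaMeasure a 1) ∂(gammaMeasure a 1)
      = ENNReal.ofReal (t * gammaPDFReal a 1 t) := by
  have := isProbabilityMeasure_gammaMeasure ha one_pos
  have := nullSingletonClass_gammaMeasure (a := a)
  set γ := gammaMeasure a 1 with hγ
  have hid := integrable_id_gammaMeasure ha
  rw [← hγ] at hid
  set q := ∫ y in Ici t, (1 : ℝ) ∂γ with hq
  set M := ∫ y in Ici t, y ∂γ with hM
  have h1 : ∀ x ∈ Iio t, ∫⁻ y in Ici t, ENNReal.ofReal (y - x) ∂γ = ENNReal.ofReal (M - x * q) := by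
    intro x hx
    have hi : IntegrableOn (fun y => y - x) (Ici t) γ :=
      (hid.sub (integrable_const x)).integrableOn
    rw [← ofReal_integral_eq_lintegral_ofReal hi,
      integral_sub hid.integrableOn (integrable_const x)]
    · simp [hM, hq, mul_comm]
    · filter_upwards [ae_restrict_mem measurableSet_Ici] with y hy
      exact sub_nonneg.2 (le_of_lt (lt_of_lt_of_le hx hy))
  have hMq : t * q ≤ M := by
    rw [hq, hM, ← integral_const_mul]
    refine setIntegral_mono_on (integrable_const _) hid.integrableOn measurableSet_Ici fun y hy => ?_
    simpa using hy
  have hq0 : 0 ≤ q := by rw [hq]; positivity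
  rw [setLIntegral_congr_fun measurableSet_Iio h1, ← ofReal_integral_eq_lintegral_ofReal]
  · congr 1
    rw [integral_sub (integrable_const _) (hid.mul_const q).integrableOn, integral_mul_const,
      ← integral_Ioi_sub_gammaMeasure ha ht, ← integral_Ici_eq_integral_Ioi,
      integral_sub hid.integrableOn (integrable_const a), ← hM]
    have e1 : ∫ y in Iio t, y ∂γ + M = a := by
      rw [hM, ← compl_Iio, integral_add_compl measurableSet_Iio hid, hγ,
        integral_id_gammaMeasure ha]
    have e2 : ∫ y in Iio t, (1 : ℝ) ∂γ + q = 1 := by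
      rw [hq, ← compl_Iio, integral_add_compl measurableSet_Iio (integrable_const _)]
      simp
    have e3 : ∀ (s : Set ℝ) (c : ℝ), ∫ y in s, c ∂γ = c * ∫ y in s, (1 : ℝ) ∂γ := fun s c => by
      rw [← integral_const_mul]; simp
    rw [e3 _ M, e3 _ a, ← hq, eq_sub_iff_add_eq.2 e2, eq_sub_iff_add_eq.2 e1]
    ring
  · exact (integrable_const _).sub (hid.mul_const q).integrableOn
  · filter_upwards [ae_restrict_mem measurableSet_Iio] with x hx
    have := mul_le_mul_of_nonneg_right (le_of_lt hx) hq0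
    exact sub_nonneg.2 (this.trans hMq)

end Gamma

/-! ### Weighted Poincaré inequality for the Gamma law -/

section GammaPoincare

open ProbabilityTheory

lemma ae_gammaMeasure_of_ae {a : ℝ} {p : ℝ → Prop}
    (h : ∀ᵐ x ∂(volume : Measure ℝ).restrict (Ioi 0), p x) : ∀ᵐ x ∂(gammaMeasure a 1), p x := by
  rw [ae_restrict_iff' measurableSet_Ioi] at h
  have hac : gammaMeasure a 1 ≪ volume := withDensity_absolutelyContinuous _ _
  filter_upwards [hac.ae_le h, ae_pos_gammaMeasure] with x hx h0 using hx h0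

/-- Twice the variance is the mean squared difference of two independent copies. -/
lemma evariance_add_self_eq {Ω : Type*} [MeasurableSpace Ω] {ν : Measure Ω}
    [IsProbabilityMeasure ν] {X : Ω → ℝ} (hX : MemLp X 2 ν) :
    evariance X ν + evariance X ν = ∫⁻ y, ∫⁻ x, ENNReal.ofReal ((X x - X y) ^ 2) ∂ν ∂ν := by
  simp only [lintegral_sq_sub_const hX]
  rw [lintegral_add_left measurable_const, lintegral_const, measure_univ, mul_one]
  congr 1
  rw [evariance_eq_lintegral_ofReal]
  refine lintegral_congr fun y => ?_
  rw [← neg_sub, neg_sq]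

/-- The total weight of the pairs `x < t ≤ y` straddling `t` is the Stein kernel `t` times the
density. For `t ≤ 0` both sides vanish. -/
lemma lintegral_ite_gammaMeasure {a t : ℝ} (ha : 0 < a) (c : ℝ → ℝ≥0∞) (hc : c t ≠ ⊤) :
    ∫⁻ y, ∫⁻ x, (if x < t ∧ t ≤ y then ENNReal.ofReal (y - x) * c t else 0)
      ∂(gammaMeasure a 1) ∂(gammaMeasure a 1) = gammaPDF a 1 t * (ENNReal.ofReal t * c t) := by
  have := isProbabilityMeasure_gammaMeasure ha one_pos
  rw [lintegral_lintegral_swap (by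
    refine (Measurable.ite ?_ (by fun_prop) measurable_const).aemeasurable
    exact (measurableSet_lt measurable_snd measurable_const).inter
      (measurableSet_le measurable_const measurable_fst))]
  rcases le_or_gt t 0 with ht | ht
  · rw [ENNReal.ofReal_of_nonpos ht, zero_mul, mul_zero]
    refine (lintegral_congr_ae ?_).trans lintegral_zero
    filter_upwards [ae_pos_gammaMeasure] with x hx
    simp [not_lt.2 (ht.trans hx.le)]
  · have e : ∀ x, ∫⁻ y, (if x < t ∧ t ≤ y then ENNReal.ofReal (y - x) * c t else 0)
        ∂(gammaMeasure a 1) = (Iio t).indicator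
          (fun x => (∫⁻ y in Ici t, ENNReal.ofReal (y - x) ∂(gammaMeasure a 1)) * c t) x := by
      intro x
      by_cases hx : x < t
      · rw [indicator_of_mem (show x ∈ Iio t from hx), ← lintegral_mul_const' _ _ hc,
          ← lintegral_indicator measurableSet_Ici]
        simp [hx, indicator_apply]
      · rw [indicator_of_notMem (show x ∉ Iio t from hx)]
        simp [hx]
    simp only [e]
    rw [lintegral_indicator measurableSet_Iio, lintegral_mul_const' _ _ hc,
      lintegral_Iio_Ici_gammaMeasure ha ht, ENNReal.ofReal_mul ht.le, ← mul_assoc, gammaPDF,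
      mul_comm (ENNReal.ofReal t)]

/-- The weighted Poincaré inequality for the Gamma distribution. -/
theorem evariance_gammaMeasure_le {a : ℝ} (ha : 0 < a) {h d : ℝ → ℝ} (hdm : Measurable d)
    (h2 : MemLp h 2 (gammaMeasure a 1)) (hd : HasWeakDirDeriv (Ioi 0) h 1 d) :
    evariance h (gammaMeasure a 1) ≤ ∫⁻ t, ENNReal.ofReal (t * d t ^ 2) ∂(gammaMeasure a 1) := by
  have := isProbabilityMeasure_gammaMeasure ha one_pos
  set γ := gammaMeasure a 1 with hγ
  let D : ℝ → ℝ≥0∞ := fun t => ENNReal.ofReal (d t ^ 2)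
  have hD : Measurable D := by fun_prop
  -- For `z = (y, x)`, this is the Cauchy–Schwarz bound `(y - x) * ∫_x^y d ^ 2`, and it is zero
  -- unless `x < y`. Hence `T (y, x) + T (x, y)` covers both orders, and the factor two cancels that
  -- of the doubled variance.
  let T : ℝ × ℝ → ℝ≥0∞ := fun z =>
    ∫⁻ t, if z.2 < t ∧ t ≤ z.1 then ENNReal.ofReal (z.1 - z.2) * D t else 0
  have hTm : Measurable fun w : (ℝ × ℝ) × ℝ =>
      if w.1.2 < w.2 ∧ w.2 ≤ w.1.1 then ENNReal.ofReal (w.1.1 - w.1.2) * D w.2 else 0 := by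
    refine Measurable.ite ?_ (by fun_prop) measurable_const
    exact (measurableSet_lt (by fun_prop) measurable_snd).inter
      (measurableSet_le measurable_snd (by fun_prop))
  have hT : Measurable T := hTm.lintegral_prod_right'
  have hTeq : ∀ x y, T (y, x) = ENNReal.ofReal (y - x) * ∫⁻ t in Ioc x y, D t := fun x y => by
    rw [← lintegral_const_mul _ hD, ← lintegral_indicator measurableSet_Ioc]
    simp [T, indicator_apply]
  have hle : ∀ᵐ y ∂γ, ∀ᵐ x ∂γ, ENNReal.ofReal ((h x - h y) ^ 2) ≤ T (y, x) + T (x, y) := by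
    have h1 := ae_gammaMeasure_of_ae (a := a)
      (hd.ae_sub_eq_integral.mono fun x hx => ae_gammaMeasure_of_ae (a := a) hx)
    filter_upwards [h1] with y hy
    filter_upwards [hy] with x hx
    rcases le_total x y with hxy | hxy
    · refine le_trans ?_ le_self_add
      rw [hTeq, ← neg_sub, neg_sq]
      refine ofReal_sq_le_of_eq_integral hdm hxy ?_
      rw [intervalIntegral.integral_symm, ← hx, neg_sub]
    · refine le_trans ?_ le_add_self
      rw [hTeq]
      exact ofReal_sq_le_of_eq_integral hdm hxy hx
  have hfin : ∫⁻ y, ∫⁻ x, T (y, x) ∂γ ∂γ = ∫⁻ t, ENNReal.ofReal (t * d t ^ 2) ∂γ := by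
    have e1 : ∀ y, ∫⁻ x, T (y, x) ∂γ =
        ∫⁻ t, ∫⁻ x, (if x < t ∧ t ≤ y then ENNReal.ofReal (y - x) * D t else 0) ∂γ := fun y => by
      refine lintegral_lintegral_swap ?_
      exact (hTm.comp (g := fun w : (ℝ × ℝ) × ℝ => _) (f := fun z : ℝ × ℝ => ((y, z.1), z.2))
        (by fun_prop)).aemeasurable
    simp only [e1]
    rw [lintegral_lintegral_swap]
    · have e2 : ∀ t, ENNReal.ofReal (t * d t ^ 2) = ENNReal.ofReal t * D t := fun t =>
        ENNReal.ofReal_mul' (sq_nonneg _)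
      simp only [e2, hγ]
      rw [lintegral_gammaMeasure (by fun_prop)]
      exact lintegral_congr fun t => lintegral_ite_gammaMeasure ha D ENNReal.ofReal_ne_top
    · exact (Measurable.lintegral_prod_right' (f := fun w : (ℝ × ℝ) × ℝ =>
        if w.2 < w.1.2 ∧ w.1.2 ≤ w.1.1 then ENNReal.ofReal (w.1.1 - w.2) * D w.1.2 else 0)
        (hTm.comp (f := fun w : (ℝ × ℝ) × ℝ => ((w.1.1, w.2), w.1.2)) (by fun_prop))).aemeasurable
  have htwo : 2 * evariance h γ ≤ 2 * ∫⁻ t, ENNReal.ofReal (t * d t ^ 2) ∂γ := by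
    rw [two_mul, two_mul, evariance_add_self_eq h2]
    calc ∫⁻ y, ∫⁻ x, ENNReal.ofReal ((h x - h y) ^ 2) ∂γ ∂γ
        ≤ ∫⁻ y, ∫⁻ x, T (y, x) + T (x, y) ∂γ ∂γ :=
          lintegral_mono_ae (hle.mono fun y hy => lintegral_mono_ae hy)
      _ = ∫⁻ y, (∫⁻ x, T (y, x) ∂γ + ∫⁻ x, T (x, y) ∂γ) ∂γ :=
          lintegral_congr fun y => lintegral_add_left (hT.comp measurable_prodMk_left) _
      _ = ∫⁻ y, ∫⁻ x, T (y, x) ∂γ ∂γ + ∫⁻ y, ∫⁻ x, T (x, y) ∂γ ∂γ :=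
          lintegral_add_left hT.lintegral_prod_right' _
      _ = _ := by
          rw [lintegral_lintegral_swap (f := fun y x => T (x, y))
            (hT.comp measurable_swap).aemeasurable, hfin]
  exact (ENNReal.mul_le_mul_iff_right (by simp) (by simp)).1 htwo

end GammaPoincare

/-! ### Polar decomposition of Liouville laws -/

section Polar

open ProbabilityTheory

lemma measurableSet_posOrthant {n : ℕ} : MeasurableSet (posOrthant n) := by
  have : posOrthant n = univ.pi fun _ => Ioi 0 := by ext; simp [posOrthant]
  rw [this]
  exact .univ_pi fun _ => measurableSet_Ioi

lemma isOpen_posOrthant {n : ℕ} : IsOpen (posOrthant n) := by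
  have : posOrthant n = univ.pi fun _ => Ioi 0 := by ext; simp [posOrthant]
  rw [this]
  exact isOpen_set_pi finite_univ fun _ _ => isOpen_Ioi

lemma sum_pos_of_mem_posOrthant {n : ℕ} (hn : 1 ≤ n) {x : Fin n → ℝ} (hx : x ∈ posOrthant n) :
    0 < ∑ i, x i :=
  Finset.sum_pos (fun i _ => hx i) ⟨⟨0, hn⟩, Finset.mem_univ _⟩

lemma smul_mem_posOrthant {n : ℕ} {x : Fin n → ℝ} {r : ℝ} (hr : 0 < r) :
    r • x ∈ posOrthant n ↔ x ∈ posOrthant n := by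
  simp [posOrthant, hr]

lemma ofReal_mul_lintegral_comp_smul {E : Type*} [NormedAddCommGroup E] [NormedSpace ℝ E]
    [FiniteDimensional ℝ E] [MeasureSpace E] [BorelSpace E] [(volume : Measure E).IsAddHaarMeasure]
    {r : ℝ} (hr : 0 < r) {F : E → ℝ≥0∞} (hF : Measurable F) :
    ENNReal.ofReal (r ^ Module.finrank ℝ E) * ∫⁻ x, F (r • x) = ∫⁻ x, F x := by
  rw [← lintegral_map hF (measurable_const_smul r), Measure.map_addHaar_smul _ hr.ne',
    lintegral_smul_measure, smul_eq_mul, ← mul_assoc,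
    abs_of_nonneg (by positivity), ← ENNReal.ofReal_mul (by positivity),
    mul_inv_cancel₀ (by positivity), ENNReal.ofReal_one, one_mul]

lemma lintegral_Ioi_comp_mul_left {r : ℝ} (hr : 0 < r) {F : ℝ → ℝ≥0∞} (hF : Measurable F) :
    ENNReal.ofReal r * ∫⁻ t in Ioi 0, F (r * t) = ∫⁻ t in Ioi 0, F t := by
  rw [← lintegral_indicator measurableSet_Ioi, ← lintegral_indicator measurableSet_Ioi]
  have := ofReal_mul_lintegral_comp_smul hr (hF.indicator (measurableSet_Ioi (a := (0 : ℝ))))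
  rw [← this]
  simp [indicator_apply, hr]

/-- The measure `∏ x i ^ (α i - 1) dx` is homogeneous of degree `∑ α i`: the Jacobian contributes
`n` and the density `∑ α i - n`. -/
lemma lintegral_posOrthant_comp_smul {n : ℕ} (α : Fin n → ℝ) {r : ℝ} (hr : 0 < r)
    {F : (Fin n → ℝ) → ℝ≥0∞} (hF : Measurable F) :
    ∫⁻ x in posOrthant n, F (r • x) * ENNReal.ofReal (∏ i, x i ^ (α i - 1)) =
      ENNReal.ofReal (r ^ (-∑ i, α i)) *
        ∫⁻ x in posOrthant n, F x * ENNReal.ofReal (∏ i, x i ^ (α i - 1)) := by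
  have hm : Measurable fun x : Fin n → ℝ => F x * ENNReal.ofReal (∏ i, x i ^ (α i - 1)) := by
    fun_prop
  rw [← lintegral_indicator measurableSet_posOrthant,
    ← lintegral_indicator measurableSet_posOrthant,
    ← ofReal_mul_lintegral_comp_smul hr (hm.indicator measurableSet_posOrthant), ← mul_assoc,
    ← ENNReal.ofReal_mul (by positivity), ← lintegral_const_mul' _ _ ENNReal.ofReal_ne_top]
  refine lintegral_congr fun x => ?_
  by_cases hx : x ∈ posOrthant n
  · have hx' := (smul_mem_posOrthant hr).2 hx
    simp only [indicator_of_mem hx, indicator_of_mem hx']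
    have e : ∏ i, (r • x) i ^ (α i - 1) = r ^ ((∑ i, α i) - n) * ∏ i, x i ^ (α i - 1) := by
      have e : ((∑ i, α i) - n : ℝ) = ∑ i, (α i - 1) := by simp [Finset.sum_sub_distrib]
      rw [e, Real.rpow_sum_of_pos hr, ← Finset.prod_mul_distrib]
      exact Finset.prod_congr rfl fun i _ => Real.mul_rpow hr.le (hx i).le
    have e2 : ENNReal.ofReal (∏ i, x i ^ (α i - 1)) =
        ENNReal.ofReal (r ^ (-∑ i, α i) * r ^ Module.finrank ℝ (Fin n → ℝ)) *
          ENNReal.ofReal (∏ i, (r • x) i ^ (α i - 1)) := by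
      rw [← ENNReal.ofReal_mul (by positivity), e, Module.finrank_fin_fun, ← mul_assoc,
        ← Real.rpow_natCast r n, ← Real.rpow_add hr, ← Real.rpow_add hr]
      ring_nf
      simp
    rw [e2]
    ring
  · have hx' := fun h => hx ((smul_mem_posOrthant hr).1 h)
    simp [indicator_of_notMem hx, indicator_of_notMem hx']

/-- Substitute `t = s(x) * r`, rescale `x` by `r`, then replace `r` by `s(y) * r`. The inner
integral then depends on neither `F` nor `g` and factors out. This avoids any surface measure on the
simplex. -/
lemma lintegral_polar {n : ℕ} (hn : 1 ≤ n) (α : Fin n → ℝ) {F : (Fin n → ℝ) → ℝ≥0∞}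
    (hF : Measurable F) {g : ℝ → ℝ} (hg : Measurable g) :
    ∫⁻ x in posOrthant n, ENNReal.ofReal ((∏ i, x i ^ (α i - 1)) * Real.exp (-∑ i, x i)) *
        ∫⁻ t in Ioi 0, ENNReal.ofReal (t ^ ((∑ i, α i) - 1) * g t) * F ((t / ∑ i, x i) • x) =
      (∫⁻ r in Ioi (0 : ℝ), ENNReal.ofReal (r ^ (-(∑ i, α i) - 1) * Real.exp (-r⁻¹))) *
        ∫⁻ x in posOrthant n, ENNReal.ofReal ((∏ i, x i ^ (α i - 1)) * g (∑ i, x i)) * F x := by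
  set A := ∑ i, α i with hA
  let p : (Fin n → ℝ) → ℝ := fun x => ∏ i, x i ^ (α i - 1)
  let s : (Fin n → ℝ) → ℝ := fun x => ∑ i, x i
  have hpm : Measurable p := by fun_prop
  have hsm : Measurable s := by fun_prop
  let H : ℝ → (Fin n → ℝ) → ℝ≥0∞ := fun r y =>
    F y * ENNReal.ofReal (g (s y)) * ENNReal.ofReal (r⁻¹ * s y ^ A * Real.exp (-(s y / r)))
  have hH : Measurable fun z : ℝ × (Fin n → ℝ) => H z.1 z.2 := by fun_prop
  have step1 : ∀ x ∈ posOrthant n, ENNReal.ofReal (p x * Real.exp (-s x)) *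
      ∫⁻ t in Ioi 0, ENNReal.ofReal (t ^ (A - 1) * g t) * F ((t / s x) • x) =
      ∫⁻ r in Ioi 0, H r (r • x) * ENNReal.ofReal (p x) := fun x hx => by
    have hs : 0 < s x := sum_pos_of_mem_posOrthant hn hx
    have hp : 0 ≤ p x := Finset.prod_nonneg fun i _ => Real.rpow_nonneg (hx i).le _
    have hm : Measurable fun t => ENNReal.ofReal (t ^ (A - 1) * g t) * F ((t / s x) • x) := by
      have : Measurable fun t : ℝ => (t / s x) • x := by fun_prop
      fun_prop
    rw [← lintegral_Ioi_comp_mul_left hs hm, ← lintegral_const_mul' _ _ ENNReal.ofReal_ne_top,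
      ← lintegral_const_mul' _ _ ENNReal.ofReal_ne_top]
    refine setLIntegral_congr_fun measurableSet_Ioi fun r hr => ?_
    have hr0 : (0 : ℝ) < r := hr
    have hsr : s (r • x) = s x * r := by simp [s, ← Finset.mul_sum, mul_comm]
    simp only [H, hsr]
    rw [mul_div_cancel_left₀ r hs.ne', mul_div_cancel_right₀ (s x) hr0.ne',
      ENNReal.ofReal_mul (q := g (s x * r)) (by positivity)]
    have e : ENNReal.ofReal (p x * Real.exp (-s x)) * ENNReal.ofReal (s x) *
        ENNReal.ofReal ((s x * r) ^ (A - 1)) =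
        ENNReal.ofReal (r⁻¹ * (s x * r) ^ A * Real.exp (-s x)) * ENNReal.ofReal (p x) := by
      rw [← ENNReal.ofReal_mul (by positivity), ← ENNReal.ofReal_mul (by positivity),
        ← ENNReal.ofReal_mul (by positivity)]
      congr 1
      rw [show (s x * r) ^ A = (s x * r) ^ (A - 1) * (s x * r) by
        rw [← Real.rpow_add_one (by positivity), sub_add_cancel]]
      field_simp
    calc _ = (ENNReal.ofReal (p x * Real.exp (-s x)) * ENNReal.ofReal (s x) *
          ENNReal.ofReal ((s x * r) ^ (A - 1))) * (F (r • x) * ENNReal.ofReal (g (s x * r))) := by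
          ring
      _ = _ := by rw [e]; ring
  have step2 : ∀ r ∈ Ioi (0 : ℝ), ∫⁻ x in posOrthant n, H r (r • x) * ENNReal.ofReal (p x) =
      ENNReal.ofReal (r ^ (-A)) * ∫⁻ x in posOrthant n, H r x * ENNReal.ofReal (p x) :=
    fun r hr => lintegral_posOrthant_comp_smul α hr (hH.comp measurable_prodMk_left)
  have step3 : ∀ y ∈ posOrthant n,
      ∫⁻ r in Ioi 0, ENNReal.ofReal (r ^ (-A)) * (H r y * ENNReal.ofReal (p y)) =
      (∫⁻ r in Ioi (0 : ℝ), ENNReal.ofReal (r ^ (-A - 1) * Real.exp (-r⁻¹))) *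
        (ENNReal.ofReal (p y * g (s y)) * F y) := fun y hy => by
    have hs : 0 < s y := sum_pos_of_mem_posOrthant hn hy
    have hp : 0 ≤ p y := Finset.prod_nonneg fun i _ => Real.rpow_nonneg (hy i).le _
    rw [← lintegral_Ioi_comp_mul_left hs (by fun_prop),
      ← lintegral_const_mul _ (by fun_prop), ← lintegral_mul_const _ (by fun_prop)]
    refine setLIntegral_congr_fun measurableSet_Ioi fun r hr => ?_
    have hr0 : (0 : ℝ) < r := hr
    simp only [H]
    have e : ENNReal.ofReal (s y) * (ENNReal.ofReal ((s y * r) ^ (-A)) *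
        ENNReal.ofReal ((s y * r)⁻¹ * s y ^ A * Real.exp (-(s y / (s y * r))))) =
        ENNReal.ofReal (r ^ (-A - 1) * Real.exp (-r⁻¹)) := by
      rw [← ENNReal.ofReal_mul (by positivity), ← ENNReal.ofReal_mul (by positivity)]
      congr 1
      rw [Real.mul_rpow hs.le hr0.le, Real.rpow_neg hs.le, Real.rpow_sub_one hr0.ne',
        show s y / (s y * r) = r⁻¹ by field_simp]
      have := (Real.rpow_pos_of_pos hs A).ne'
      field_simp
    rw [← e, ENNReal.ofReal_mul hp]
    ring
  calc _ = ∫⁻ x in posOrthant n, ∫⁻ r in Ioi 0, H r (r • x) * ENNReal.ofReal (p x) :=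
        setLIntegral_congr_fun measurableSet_posOrthant step1
    _ = ∫⁻ r in Ioi 0, ∫⁻ x in posOrthant n, H r (r • x) * ENNReal.ofReal (p x) := by
        refine lintegral_lintegral_swap (Measurable.aemeasurable ?_)
        have : Measurable fun z : (Fin n → ℝ) × ℝ => H z.2 (z.2 • z.1) :=
          hH.comp (f := fun z : (Fin n → ℝ) × ℝ => (z.2, z.2 • z.1)) (by fun_prop)
        exact this.mul (hpm.comp measurable_fst).ennreal_ofReal
    _ = ∫⁻ r in Ioi 0, ENNReal.ofReal (r ^ (-A)) *
          ∫⁻ x in posOrthant n, H r x * ENNReal.ofReal (p x) :=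
        setLIntegral_congr_fun measurableSet_Ioi step2
    _ = ∫⁻ r in Ioi (0 : ℝ), ∫⁻ x in posOrthant n, ENNReal.ofReal (r ^ (-A)) *
          (H r x * ENNReal.ofReal (p x)) :=
        lintegral_congr fun r => (lintegral_const_mul' _ _ ENNReal.ofReal_ne_top).symm
    _ = ∫⁻ x in posOrthant n, ∫⁻ r in Ioi (0 : ℝ), ENNReal.ofReal (r ^ (-A)) *
          (H r x * ENNReal.ofReal (p x)) := by
        refine lintegral_lintegral_swap (Measurable.aemeasurable ?_)
        fun_prop
    _ = ∫⁻ x in posOrthant n,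
          (∫⁻ r in Ioi (0 : ℝ), ENNReal.ofReal (r ^ (-A - 1) * Real.exp (-r⁻¹))) *
            (ENNReal.ofReal (p x * g (s x)) * F x) :=
        setLIntegral_congr_fun measurableSet_posOrthant step3
    _ = _ := lintegral_const_mul _ (by fun_prop)

lemma lawPropTo_apply_univ {E : Type*} [MeasureSpace E] (Ω : Set E) (ρ : E → ℝ) :
    lawPropTo Ω ρ univ = (∫⁻ x in Ω, ENNReal.ofReal (ρ x))⁻¹ * ∫⁻ x in Ω, ENNReal.ofReal (ρ x) := by
  simp [lawPropTo, withDensity_apply]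

lemma lintegral_lawPropTo {E : Type*} [MeasureSpace E] {Ω : Set E} {ρ : E → ℝ}
    (hρ : Measurable ρ) {F : E → ℝ≥0∞} (hF : Measurable F) :
    ∫⁻ x, F x ∂(lawPropTo Ω ρ) =
      (∫⁻ x in Ω, ENNReal.ofReal (ρ x))⁻¹ * ∫⁻ x in Ω, ENNReal.ofReal (ρ x) * F x := by
  rw [lawPropTo, lintegral_smul_measure,
    lintegral_withDensity_eq_lintegral_mul _ hρ.ennreal_ofReal hF]
  simp [withDensity_apply]

lemma isProbabilityMeasure_lawPropTo_iff {E : Type*} [MeasureSpace E] {Ω : Set E} {ρ : E → ℝ} :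
    IsProbabilityMeasure (lawPropTo Ω ρ) ↔
      ∫⁻ x in Ω, ENNReal.ofReal (ρ x) ≠ 0 ∧ ∫⁻ x in Ω, ENNReal.ofReal (ρ x) ≠ ⊤ := by
  rw [isProbabilityMeasure_iff, lawPropTo_apply_univ]
  constructor
  · intro h
    constructor <;> intro h0 <;> simp [h0] at h
  · rintro ⟨h0, h1⟩
    exact ENNReal.inv_mul_cancel h0 h1

lemma lawPropTo_absolutelyContinuous {E : Type*} [MeasureSpace E] (Ω : Set E) (ρ : E → ℝ) :
    lawPropTo Ω ρ ≪ (volume : Measure E).restrict Ω :=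
  Measure.AbsolutelyContinuous.trans Measure.smul_absolutelyContinuous
    (withDensity_absolutelyContinuous _ _)

/-- A probability measure proportional to `m` is the normalization of `m`, so the Gamma constants
need no further computation. -/
lemma eq_inv_smul_of_eq_smul {E : Type*} [MeasurableSpace E] {P m : Measure E}
    [IsProbabilityMeasure P] {c : ℝ≥0∞} (h : P = c • m) : P = (m univ)⁻¹ • m := by
  have h1 : c * m univ = 1 := by
    rw [← smul_eq_mul, ← Measure.smul_apply, ← h, measure_univ]
  rw [← ENNReal.eq_inv_of_mul_eq_one_left h1, h]

lemma volume_withDensity_eq_smul_restrict {E : Type*} [MeasureSpace E] {Ω : Set E}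
    (hΩ : MeasurableSet Ω) {q ρ : E → ℝ≥0∞} (hρ : Measurable ρ) {c : ℝ≥0∞}
    (h1 : ∀ᵐ x, x ∈ Ω → q x = c * ρ x) (h2 : ∀ᵐ x, x ∉ Ω → q x = 0) :
    (volume : Measure E).withDensity q = c • ((volume : Measure E).restrict Ω).withDensity ρ := by
  rw [← withDensity_smul _ hρ, ← withDensity_indicator hΩ]
  refine withDensity_congr_ae ?_
  filter_upwards [h1, h2] with x hx1 hx2
  by_cases hx : x ∈ Ω
  · simp [hx, hx1 hx]
  · simp [hx, hx2 hx]

lemma gammaMeasure_eq_lawPropTo {a : ℝ} (ha : 0 < a) :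
    gammaMeasure a 1 = lawPropTo (Ioi 0) fun s => s ^ (a - 1) * Real.exp (-s) := by
  have := isProbabilityMeasure_gammaMeasure ha one_pos
  have hG : (0 : ℝ) ≤ (Real.Gamma a)⁻¹ := (inv_pos.2 (Real.Gamma_pos_of_pos ha)).le
  refine eq_inv_smul_of_eq_smul (c := ENNReal.ofReal (Real.Gamma a)⁻¹) ?_
  refine volume_withDensity_eq_smul_restrict measurableSet_Ioi (by fun_prop) (.of_forall ?_) ?_
  · intro x hx
    rw [gammaPDF, gammaPDFReal_one_of_pos hx, ENNReal.ofReal_mul hG]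
  · filter_upwards [Measure.ae_ne volume (0 : ℝ)] with x hx h
    exact gammaPDF_of_neg (lt_of_le_of_ne (not_lt.1 h) hx)

lemma isProbabilityMeasure_pi_gammaMeasure {n : ℕ} {α : Fin n → ℝ} (hα : ∀ i, 0 < α i) :
    IsProbabilityMeasure (Measure.pi fun i => gammaMeasure (α i) 1) := by
  have := fun i => isProbabilityMeasure_gammaMeasure (hα i) one_pos
  infer_instance

lemma ae_volume_pi_ne {n : ℕ} : ∀ᵐ x : Fin n → ℝ, ∀ i, x i ≠ 0 := by
  refine ae_all_iff.2 fun i => ?_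
  have := (Measure.quasiMeasurePreserving_eval (fun _ : Fin n => (volume : Measure ℝ)) i).ae
    (Measure.ae_ne volume (0 : ℝ))
  exact this

lemma pi_gammaMeasure_eq_liouvilleLaw {n : ℕ} {α : Fin n → ℝ} (hα : ∀ i, 0 < α i) :
    (Measure.pi fun i => gammaMeasure (α i) 1) = liouvilleLaw α fun s => Real.exp (-s) := by
  have := fun i => isProbabilityMeasure_gammaMeasure (hα i) one_pos
  have hG : ∀ i, (0 : ℝ) ≤ (Real.Gamma (α i))⁻¹ := fun i =>
    (inv_pos.2 (Real.Gamma_pos_of_pos (hα i))).le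
  have hm : ∀ i, Measurable (gammaPDF (α i) 1) := fun i =>
    (measurable_gammaPDFReal (α i) 1).ennreal_ofReal
  refine eq_inv_smul_of_eq_smul (c := ∏ i, ENNReal.ofReal (Real.Gamma (α i))⁻¹) ?_
  simp only [gammaMeasure] at this ⊢
  rw [pi_withDensity hm]
  refine volume_withDensity_eq_smul_restrict measurableSet_posOrthant (by fun_prop)
    (.of_forall ?_) ?_
  · intro x hx
    have e : (∏ i, x i ^ (α i - 1)) * Real.exp (-∑ i, x i) =
        ∏ i, (x i ^ (α i - 1) * Real.exp (-x i)) := by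
      rw [Finset.prod_mul_distrib, ← Real.exp_sum, Finset.sum_neg_distrib]
    rw [e, ENNReal.ofReal_prod_of_nonneg fun i _ =>
      mul_nonneg (Real.rpow_nonneg (hx i).le _) (Real.exp_pos _).le, ← Finset.prod_mul_distrib]
    refine Finset.prod_congr rfl fun i _ => ?_
    rw [gammaPDF, gammaPDFReal_one_of_pos (hx i), ENNReal.ofReal_mul (hG i)]
  · filter_upwards [ae_volume_pi_ne] with x hx h
    simp only [posOrthant, mem_ofPred_eq, not_forall, not_lt] at h
    obtain ⟨i, hi⟩ := h
    exact Finset.prod_eq_zero (Finset.mem_univ i) (gammaPDF_of_neg (lt_of_le_of_ne hi (hx i)))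

/-- The constant is independent of `g`, so it can be read off from `g = exp (-·)`, `F = 1`, where
the orthant integral appears on both sides and cancels. -/
lemma lintegral_polar_constant {n : ℕ} (hn : 1 ≤ n) {α : Fin n → ℝ} (hα : ∀ i, 0 < α i) :
    ∫⁻ r in Ioi (0 : ℝ), ENNReal.ofReal (r ^ (-(∑ i, α i) - 1) * Real.exp (-r⁻¹)) =
      ∫⁻ t in Ioi (0 : ℝ), ENNReal.ofReal (t ^ ((∑ i, α i) - 1) * Real.exp (-t)) := by
  have h := lintegral_polar hn α (F := 1) measurable_one (g := fun s => Real.exp (-s))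
    (by fun_prop)
  simp only [Pi.one_apply, mul_one] at h
  have := isProbabilityMeasure_pi_gammaMeasure hα
  rw [pi_gammaMeasure_eq_liouvilleLaw hα] at this
  obtain ⟨h0, h1⟩ := isProbabilityMeasure_lawPropTo_iff.1 this
  rw [lintegral_mul_const _ (by fun_prop), mul_comm] at h
  exact ((ENNReal.mul_left_inj h0 h1).1 h).symm

/-- Polar decomposition of a Liouville law: the radius is independent of the direction, and the
direction has the same law as that of independent Gamma variables. -/
theorem measurePreserving_polar {n : ℕ} (hn : 1 ≤ n) {α : Fin n → ℝ} (hα : ∀ i, 0 < α i)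
    {g : ℝ → ℝ} (hg : Measurable g) (hμ : IsProbabilityMeasure (liouvilleLaw α g)) :
    IsProbabilityMeasure (radialLaw α g) ∧
    MeasurePreserving (fun z : ℝ × (Fin n → ℝ) => (z.1 / ∑ i, z.2 i) • z.2)
      ((radialLaw α g).prod (Measure.pi fun i => gammaMeasure (α i) 1)) (liouvilleLaw α g) := by
  have hA : 0 < ∑ i, α i := Finset.sum_pos (fun i _ => hα i) ⟨⟨0, hn⟩, Finset.mem_univ _⟩
  have hγ := isProbabilityMeasure_pi_gammaMeasure hα
  have hγ' := hγ
  rw [pi_gammaMeasure_eq_liouvilleLaw hα] at hγ'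
  obtain ⟨hM0, hM1⟩ := isProbabilityMeasure_lawPropTo_iff.1 hγ'
  obtain ⟨hZ0, hZ1⟩ := isProbabilityMeasure_lawPropTo_iff.1 hμ
  have hc := isProbabilityMeasure_gammaMeasure hA one_pos
  rw [gammaMeasure_eq_lawPropTo hA] at hc
  obtain ⟨hc0, hc1⟩ := isProbabilityMeasure_lawPropTo_iff.1 hc
  rw [← lintegral_polar_constant hn hα] at hc0 hc1
  have hpol := fun (F : (Fin n → ℝ) → ℝ≥0∞) (hF : Measurable F) =>
    lintegral_polar hn α hF hg
  have h1 := hpol 1 measurable_one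
  simp only [Pi.one_apply, mul_one] at h1
  rw [lintegral_mul_const _ (by fun_prop)] at h1
  have hρ : Measurable fun x : Fin n → ℝ => (∏ i, x i ^ (α i - 1)) * g (∑ i, x i) := by fun_prop
  have hρS : Measurable fun s : ℝ => s ^ ((∑ i, α i) - 1) * g s := by fun_prop
  have hρe : Measurable fun x : Fin n → ℝ =>
    (∏ i, x i ^ (α i - 1)) * Real.exp (-∑ i, x i) := by fun_prop
  set c := ∫⁻ r in Ioi (0 : ℝ), ENNReal.ofReal (r ^ (-(∑ i, α i) - 1) * Real.exp (-r⁻¹))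
  set M := ∫⁻ x in posOrthant n, ENNReal.ofReal ((∏ i, x i ^ (α i - 1)) * Real.exp (-∑ i, x i))
    with hM
  set Z := ∫⁻ x in posOrthant n, ENNReal.ofReal ((∏ i, x i ^ (α i - 1)) * g (∑ i, x i)) with hZ
  set ZS := ∫⁻ t in Ioi (0 : ℝ), ENNReal.ofReal (t ^ ((∑ i, α i) - 1) * g t) with hZS
  -- `M * ZS = c * Z`, so finiteness and positivity of the radial normalization follow from those of
  -- `Z`.
  have hprod : M * ZS ≠ 0 ∧ M * ZS ≠ ⊤ := by
    rw [h1]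
    exact ⟨mul_ne_zero hc0 hZ0, ENNReal.mul_ne_top hc1 hZ1⟩
  have hS : IsProbabilityMeasure (radialLaw α g) := by
    refine isProbabilityMeasure_lawPropTo_iff.2 ⟨?_, ?_⟩ <;> rw [← hZS]
    · exact right_ne_zero_of_mul hprod.1
    · intro h
      rw [h, ENNReal.mul_top hM0] at hprod
      exact hprod.2 rfl
  have hS' : IsProbabilityMeasure (lawPropTo (Ioi 0) fun s => s ^ ((∑ i, α i) - 1) * g s) := hS
  refine ⟨hS, by fun_prop, Measure.ext_of_lintegral _ fun F hF => ?_⟩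
  have hφ : Measurable fun z : ℝ × (Fin n → ℝ) => (z.1 / ∑ i, z.2 i) • z.2 := by fun_prop
  have hFφ : Measurable fun z : ℝ × (Fin n → ℝ) => F ((z.1 / ∑ i, z.2 i) • z.2) := hF.comp hφ
  rw [lintegral_map hF hφ, lintegral_prod_symm _ hFφ.aemeasurable,
    pi_gammaMeasure_eq_liouvilleLaw hα]
  simp only [radialLaw, liouvilleLaw]
  rw [lintegral_lawPropTo hρe hFφ.lintegral_prod_left', lintegral_lawPropTo hρ hF]
  have e : ∀ x : Fin n → ℝ, ∫⁻ t, F ((t / ∑ i, x i) • x)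
      ∂(lawPropTo (Ioi 0) fun s => s ^ ((∑ i, α i) - 1) * g s) = ZS⁻¹ *
        ∫⁻ t in Ioi 0, ENNReal.ofReal (t ^ ((∑ i, α i) - 1) * g t) * F ((t / ∑ i, x i) • x) :=
    fun x => lintegral_lawPropTo hρS (hFφ.comp measurable_prodMk_right)
  simp only [e]
  have hZS0 : ZS⁻¹ ≠ ⊤ := ENNReal.inv_ne_top.2 (right_ne_zero_of_mul hprod.1)
  rw [← hM, ← hZ]
  simp only [mul_left_comm _ ZS⁻¹]
  rw [lintegral_const_mul' _ _ hZS0, hpol F hF, ← mul_assoc, ← mul_assoc]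
  congr 1
  rw [← ENNReal.mul_inv (Or.inl hM0) (Or.inl hM1), h1,
    ENNReal.mul_inv (Or.inl hc0) (Or.inl hc1), mul_right_comm, ENNReal.inv_mul_cancel hc0 hc1,
    one_mul]

/-- Taking `g = exp (-·)` makes the Liouville law the product of Gamma laws itself: the sum of the
coordinates is Gamma(`∑ α i`) and independent of the direction. -/
lemma measurePreserving_polar_gammaMeasure {n : ℕ} (hn : 1 ≤ n) {α : Fin n → ℝ}
    (hα : ∀ i, 0 < α i) :
    MeasurePreserving (fun z : ℝ × (Fin n → ℝ) => (z.1 / ∑ i, z.2 i) • z.2)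
      ((gammaMeasure (∑ i, α i) 1).prod (Measure.pi fun i => gammaMeasure (α i) 1))
      (Measure.pi fun i => gammaMeasure (α i) 1) := by
  have hA : 0 < ∑ i, α i := Finset.sum_pos (fun i _ => hα i) ⟨⟨0, hn⟩, Finset.mem_univ _⟩
  have h := (measurePreserving_polar hn hα (g := fun s => Real.exp (-s)) (by fun_prop)
    (by rw [← pi_gammaMeasure_eq_liouvilleLaw hα]
        exact isProbabilityMeasure_pi_gammaMeasure hα)).2
  rwa [← pi_gammaMeasure_eq_liouvilleLaw hα, radialLaw, ← gammaMeasure_eq_lawPropTo hA] at h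

end Polar

/-! ### Comparison of Gamma and Lebesgue measures on compacts; limits and integration by parts -/

section Curves

open ProbabilityTheory Filter Topology

/-- The Gamma density is bounded below on compact subsets of `(0,∞)`. The next lemma uses the
reverse bound on boxes. Together they transfer Lebesgue `L¹` estimates on the orthant to Lebesgue
estimates along curves. -/
lemma exists_setLIntegral_le_gammaMeasure {a : ℝ} (ha : 0 < a) (m : ℕ) :
    ∃ B : ℝ≥0∞, B ≠ ⊤ ∧ ∀ u : ℝ → ℝ≥0∞, Measurable u →
      ∫⁻ t in exhIcc m, u t ≤ B * ∫⁻ t in exhIcc m, u t ∂(gammaMeasure a 1) := by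
  have hc : ContinuousOn (fun x : ℝ => (Real.Gamma a)⁻¹ * (x ^ (a - 1) * Real.exp (-x)))
      (exhIcc m) := by
    refine continuousOn_const.mul (ContinuousOn.mul ?_ (by fun_prop))
    exact continuousOn_id.rpow_const fun x hx => Or.inl (exhIcc_subset_Ioi m hx).ne'
  obtain ⟨k, hk⟩ := exists_mem_exhIcc (isCompact_exhIcc m) hc fun x hx => by
    have : 0 < x := exhIcc_subset_Ioi m hx
    have := Real.Gamma_pos_of_pos ha
    positivity
  refine ⟨ENNReal.ofReal (k + 1), ENNReal.ofReal_ne_top, fun u hu => ?_⟩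
  have hm : MeasurableSet (exhIcc m) := (isCompact_exhIcc m).measurableSet
  rw [gammaMeasure, restrict_withDensity hm,
    lintegral_withDensity_eq_lintegral_mul _
      (show Measurable (gammaPDF a 1) from (measurable_gammaPDFReal a 1).ennreal_ofReal) hu,
    ← lintegral_const_mul' _ _ ENNReal.ofReal_ne_top]
  refine setLIntegral_mono' hm fun x hx => ?_
  rw [Pi.mul_apply, ← mul_assoc]
  refine le_mul_of_one_le_left' ?_
  rw [gammaPDF, ← ENNReal.ofReal_mul (by positivity), ENNReal.one_le_ofReal,
    gammaPDFReal_one_of_pos (exhIcc_subset_Ioi m hx)]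
  have := (hk x hx).1
  rw [div_le_iff₀ (by positivity)] at this
  linarith

lemma exists_setLIntegral_pi_gammaMeasure_le {n : ℕ} {α : Fin n → ℝ} (hα : ∀ i, 0 < α i) (m : ℕ) :
    ∃ B : ℝ≥0∞, B ≠ ⊤ ∧ ∀ u : (Fin n → ℝ) → ℝ≥0∞, Measurable u →
      ∫⁻ x in exhBox n m, u x ∂(Measure.pi fun i => gammaMeasure (α i) 1) ≤
        B * ∫⁻ x in exhBox n m, u x := by
  have hγ := isProbabilityMeasure_pi_gammaMeasure hα
  rw [pi_gammaMeasure_eq_liouvilleLaw hα] at hγ ⊢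
  obtain ⟨h0, h1⟩ := isProbabilityMeasure_lawPropTo_iff.1 hγ
  have hm : MeasurableSet (exhBox n m) := (isCompact_exhBox n m).measurableSet
  have hc : ContinuousOn (fun x : Fin n → ℝ => (∏ i, x i ^ (α i - 1)) * Real.exp (-∑ i, x i))
      (exhBox n m) := by
    refine ContinuousOn.mul (continuousOn_finsetProd _ fun i _ => ?_) (by fun_prop)
    exact (continuous_apply i).continuousOn.rpow_const
      fun x hx => Or.inl (exhBox_subset_posOrthant n m hx i).ne'
  obtain ⟨c, hcb⟩ := (isCompact_exhBox n m).exists_bound_of_continuousOn hc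
  refine ⟨_, ENNReal.mul_ne_top (ENNReal.inv_ne_top.2 h0) (ENNReal.ofReal_ne_top (r := c)),
    fun u hu => ?_⟩
  rw [← lintegral_indicator hm, liouvilleLaw,
    lintegral_lawPropTo (by fun_prop) (hu.indicator hm), mul_assoc]
  gcongr
  rw [← lintegral_const_mul' _ _ ENNReal.ofReal_ne_top, ← lintegral_indicator measurableSet_posOrthant,
    ← lintegral_indicator hm]
  refine lintegral_mono fun x => ?_
  by_cases hx : x ∈ exhBox n m
  · simp only [indicator_of_mem hx, indicator_of_mem (exhBox_subset_posOrthant n m hx)]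
    gcongr
    exact (le_abs_self _).trans (hcb x hx)
  · simp [hx]

lemma tendsto_integral_mul_of_lintegral_enorm_sub {I : Set ℝ} (hI : MeasurableSet I)
    {G : ℕ → ℝ → ℝ} {g b : ℝ → ℝ}
    (hG : ∀ k, IntegrableOn (G k) I) (hg : IntegrableOn g I) {c : ℝ} (hb : ∀ t ∈ I, ‖b t‖ ≤ c)
    (hbm : AEStronglyMeasurable b (volume.restrict I))
    (h : Tendsto (fun k => ∫⁻ t in I, ‖G k t - g t‖ₑ) atTop (𝓝 0)) :
    Tendsto (fun k => ∫ t in I, G k t * b t) atTop (𝓝 (∫ t in I, g t * b t)) := by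
  have hb' : ∀ᵐ t ∂volume.restrict I, ‖b t‖ ≤ c := by
    filter_upwards [ae_restrict_mem hI] with t ht using hb t ht
  refine tendsto_integral_of_L1 _ (hg.mul_bdd hbm hb').aestronglyMeasurable
    (Eventually.of_forall fun k => (hG k).mul_bdd hbm hb') ?_
  have h2 : Tendsto (fun k => (∫⁻ t in I, ‖G k t - g t‖ₑ) * ENNReal.ofReal c) atTop (𝓝 0) := by
    simpa using ENNReal.Tendsto.mul_const h (Or.inr ENNReal.ofReal_ne_top)
  refine tendsto_of_tendsto_of_tendsto_of_le_of_le tendsto_const_nhds h2 (fun _ => bot_le)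
    fun k => ?_
  dsimp only
  rw [← lintegral_mul_const' _ _ ENNReal.ofReal_ne_top]
  refine setLIntegral_mono' hI fun t ht => ?_
  rw [← sub_mul, enorm_mul]
  gcongr
  rw [← ofReal_norm]
  exact ENNReal.ofReal_le_ofReal (hb t ht)

lemma integral_mul_deriv_eq_neg_of_vanish {a b : ℝ} (hab : a ≤ b) {u u' φ : ℝ → ℝ}
    (hu : ∀ t ∈ Icc a b, HasDerivAt u (u' t) t) (hu' : ContinuousOn u' (Icc a b))
    (hφ : ContDiff ℝ 1 φ) (ha : φ a = 0) (hb : φ b = 0) :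
    ∫ t in Icc a b, u t * fderiv ℝ φ t 1 = -∫ t in Icc a b, u' t * φ t := by
  rw [integral_Icc_eq_integral_Ioc, integral_Icc_eq_integral_Ioc,
    ← intervalIntegral.integral_of_le hab, ← intervalIntegral.integral_of_le hab]
  have := intervalIntegral.integral_mul_deriv_eq_deriv_mul (u := u) (v := φ) (u' := u')
    (v' := fun t => fderiv ℝ φ t 1) (a := a) (b := b)
    (fun t ht => hu t (by rwa [uIcc_of_le hab] at ht))
    (fun t _ => (hφ.differentiable one_ne_zero t).hasDerivAt)
    (hu'.intervalIntegrable_of_Icc hab) ((hφ.continuous_deriv le_rfl).intervalIntegrable _ _)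
  rw [this, ha, hb]
  simp

end Curves

/-! ### Weak differentiability along almost every curve -/

section Curves

open ProbabilityTheory Filter Topology

/-- A Fubini bound for a family of curves sweeping out the product Gamma law: what is small in `L¹`
on a box is small in `L¹` along the curves, on average over the parameter `p`. -/
lemma exists_lintegral_curve_le {n : ℕ} {α : Fin n → ℝ} (hα : ∀ i, 0 < α i) {a : ℝ} (ha : 0 < a)
    {P : Type*} [MeasurableSpace P] {π : Measure P} {Φ : P → ℝ → Fin n → ℝ}
    (hΦ : MeasurePreserving (fun z : P × ℝ => Φ z.1 z.2) (π.prod (gammaMeasure a 1))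
      (Measure.pi fun i => gammaMeasure (α i) 1)) (m k : ℕ) :
    ∃ B : ℝ≥0∞, B ≠ ⊤ ∧ ∀ u : (Fin n → ℝ) → ℝ≥0∞, Measurable u →
      ∫⁻ p, (∫⁻ t in exhIcc m, (exhBox n k).indicator u (Φ p t)) ∂π ≤
        B * ∫⁻ x in exhBox n k, u x := by
  have := isProbabilityMeasure_gammaMeasure ha one_pos
  obtain ⟨B₁, hB₁, h₁⟩ := exists_setLIntegral_le_gammaMeasure ha m
  obtain ⟨B₂, hB₂, h₂⟩ := exists_setLIntegral_pi_gammaMeasure_le hα k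
  refine ⟨B₁ * B₂, ENNReal.mul_ne_top hB₁ hB₂, fun u hu => ?_⟩
  have hk : MeasurableSet (exhBox n k) := (isCompact_exhBox n k).measurableSet
  have hm : Measurable fun z : P × ℝ => (exhBox n k).indicator u (Φ z.1 z.2) :=
    (hu.indicator hk).comp hΦ.measurable
  calc ∫⁻ p, (∫⁻ t in exhIcc m, (exhBox n k).indicator u (Φ p t)) ∂π
      ≤ ∫⁻ p, B₁ * ∫⁻ t, (exhBox n k).indicator u (Φ p t) ∂(gammaMeasure a 1) ∂π :=
        lintegral_mono fun p => (h₁ _ (hm.comp measurable_prodMk_left)).trans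
          (mul_le_mul_right (setLIntegral_le_lintegral _ _) _)
    _ = B₁ * ∫⁻ x in exhBox n k, u x ∂(Measure.pi fun i => gammaMeasure (α i) 1) := by
        rw [lintegral_const_mul' _ _ hB₁, ← lintegral_prod _ hm.aemeasurable,
          hΦ.lintegral_comp (hu.indicator hk), lintegral_indicator hk]
    _ ≤ B₁ * (B₂ * ∫⁻ x in exhBox n k, u x) := by gcongr; exact h₂ u hu
    _ = _ := (mul_assoc _ _ _).symm

/-- A weakly differentiable function is weakly differentiable along almost every curve of a family
of curves, with the derivative given by the chain rule. -/
theorem ae_hasWeakDirDeriv_comp {n : ℕ} {α : Fin n → ℝ} (hα : ∀ i, 0 < α i) {a : ℝ} (ha : 0 < a)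
    {P : Type*} [MeasurableSpace P] {π : Measure P} {Φ v : P → ℝ → Fin n → ℝ}
    (hΦ : MeasurePreserving (fun z : P × ℝ => Φ z.1 z.2) (π.prod (gammaMeasure a 1))
      (Measure.pi fun i => gammaMeasure (α i) 1))
    (hΦd : ∀ᵐ p ∂π, ∀ t, 0 < t → HasDerivAt (Φ p) (v p t) t)
    (hv : ∀ᵐ p ∂π, ContinuousOn (v p) (Ioi 0))
    (hO : ∀ᵐ p ∂π, ∀ t, 0 < t → Φ p t ∈ posOrthant n)
    {f : (Fin n → ℝ) → ℝ} {d : Fin n → (Fin n → ℝ) → ℝ} (hfm : Measurable f)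
    (hdm : ∀ i, Measurable (d i)) (hf : LocallyIntegrableOn f (posOrthant n))
    (hd : ∀ i, HasWeakDirDeriv (posOrthant n) f (Pi.single i 1) (d i)) :
    ∀ᵐ p ∂π, HasWeakDirDeriv (Ioi 0) (fun t => f (Φ p t)) 1
      fun t => ∑ j, d j (Φ p t) * v p t j := by
  have hgm := isProbabilityMeasure_gammaMeasure ha one_pos
  have hε : ∀ l : ℕ, (0 : ℝ≥0∞) < 2⁻¹ ^ l := fun l => ENNReal.pow_pos (by simp) l
  choose B hB hBle using exists_lintegral_curve_le hα ha hΦ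
  -- `F k l` is smooth and approximates `f` and its weak derivatives on box `k` with `L¹` error `2⁻¹
  -- ^ l`. The rate gives convergence on almost every curve without extracting subsequences.
  choose F hF1 hF2 hF3 using fun k l : ℕ => exists_contDiff_lintegral_sub_le hd hf
    isOpen_posOrthant (isCompact_exhBox n k) (exhBox_subset_posOrthant n k) (hε l)
  have hF1' : ∀ k l, ContDiff ℝ 1 (F k l) := fun k l => (hF1 k l).of_le (by exact_mod_cast le_top)
  have hFd : ∀ k l i, Continuous fun x => fderiv ℝ (F k l) x (Pi.single i 1) := fun k l i =>
    ((hF1' k l).continuous_fderiv one_ne_zero).clm_apply continuous_const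
  have hJm : ∀ (m k : ℕ) (u : (Fin n → ℝ) → ℝ≥0∞), Measurable u →
      Measurable fun p => ∫⁻ t in exhIcc m, (exhBox n k).indicator u (Φ p t) :=
    fun m k u hu => Measurable.lintegral_prod_right'
      (f := fun z : P × ℝ => (exhBox n k).indicator u (Φ z.1 z.2))
      ((hu.indicator (isCompact_exhBox n k).measurableSet).comp hΦ.measurable)
  have hfin : ∀ (u : (Fin n → ℝ) → ℝ), Measurable u → LocallyIntegrableOn u (posOrthant n) →
      ∀ᵐ p ∂π, ∀ m k, ∫⁻ t in exhIcc m, (exhBox n k).indicator (fun x => ‖u x‖ₑ) (Φ p t) < ⊤ :=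
    fun u hu hul => by
      refine ae_all_iff.2 fun m => ae_all_iff.2 fun k => ae_lt_top (hJm m k _ hu.enorm) ?_
      refine ((hBle m k _ hu.enorm).trans_lt (ENNReal.mul_lt_top (hB m k).lt_top ?_)).ne
      exact (hul.integrableOn_compact_subset (exhBox_subset_posOrthant n k)
        (isCompact_exhBox n k)).2
  have hconv : ∀ (u : (Fin n → ℝ) → ℝ) (U : ℕ → ℕ → (Fin n → ℝ) → ℝ), Measurable u →
      (∀ k l, Measurable (U k l)) →
      (∀ k l, ∫⁻ x in exhBox n k, ‖U k l x - u x‖ₑ ≤ 2⁻¹ ^ l) →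
      ∀ᵐ p ∂π, ∀ m k, Tendsto (fun l => ∫⁻ t in exhIcc m,
        (exhBox n k).indicator (fun x => ‖U k l x - u x‖ₑ) (Φ p t)) atTop (𝓝 0) :=
    fun u U hu hU hle => by
      refine ae_all_iff.2 fun m => ae_all_iff.2 fun k => ?_
      refine ae_tendsto_zero_of_lintegral_le
        (fun l => (hJm m k _ ((hU k l).sub hu).enorm).aemeasurable) (hB m k) fun l => ?_
      refine (hBle m k _ ((hU k l).sub hu).enorm).trans ?_
      gcongr
      exact hle k l
  filter_upwards [hΦd, hv, hO, hfin f hfm hf, ae_all_iff.2 fun i => hfin (d i) (hdm i) (hd i).2.1,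
    hconv f F hfm (fun k l => (hF1 k l).continuous.measurable) hF2,
    ae_all_iff.2 fun i => hconv (d i) (fun k l x => fderiv ℝ (F k l) x (Pi.single i 1)) (hdm i)
      (fun k l => (hFd k l i).measurable) (fun k l => hF3 k l i)]
    with p hpd hpv hpO hpf hpdi hcf hcd
  have hΦp : Measurable (Φ p) := hΦ.measurable.comp measurable_prodMk_left
  have hΦc : ContinuousOn (Φ p) (Ioi 0) := fun t ht => (hpd t ht).continuousAt.continuousWithinAt
  have hmI : ∀ m, MeasurableSet (exhIcc m) := fun m => (isCompact_exhIcc m).measurableSet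
  have hbox : ∀ m, ∃ k, ∀ t ∈ exhIcc m, Φ p t ∈ exhBox n k := fun m =>
    exists_mem_exhBox (isCompact_exhIcc m) (hΦc.mono (exhIcc_subset_Ioi m))
      fun t ht => hpO t (exhIcc_subset_Ioi m ht)
  have hind : ∀ {m k : ℕ} (u : (Fin n → ℝ) → ℝ≥0∞), (∀ t ∈ exhIcc m, Φ p t ∈ exhBox n k) →
      ∫⁻ t in exhIcc m, (exhBox n k).indicator u (Φ p t) = ∫⁻ t in exhIcc m, u (Φ p t) :=
    fun u h => setLIntegral_congr_fun (hmI _) fun t ht => by simp [h t ht]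
  have hint : ∀ (u : (Fin n → ℝ) → ℝ), Measurable u →
      (∀ m k, ∫⁻ t in exhIcc m, (exhBox n k).indicator (fun x => ‖u x‖ₑ) (Φ p t) < ⊤) →
      ∀ m, IntegrableOn (fun t => u (Φ p t)) (exhIcc m) := fun u hu hlt m => by
    obtain ⟨k, hk⟩ := hbox m
    refine ⟨(hu.comp hΦp).aestronglyMeasurable, ?_⟩
    have := hlt m k
    rwa [hind _ hk] at this
  have hfint := hint f hfm hpf
  have hdint := fun i => hint (d i) (hdm i) (hpdi i)
  have hvc : ∀ m j, ContinuousOn (fun t => v p t j) (exhIcc m) := fun m j =>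
    (continuousOn_pi.1 hpv j).mono (exhIcc_subset_Ioi m)
  have hdvint : ∀ m j, IntegrableOn (fun t => d j (Φ p t) * v p t j) (exhIcc m) := fun m j =>
    (hdint j m).mul_continuousOn (hvc m j) (isCompact_exhIcc m)
  have hlocal : ∀ {u : ℝ → ℝ}, (∀ m, IntegrableOn u (exhIcc m)) →
      LocallyIntegrableOn u (Ioi 0) := fun hu => by
    rw [locallyIntegrableOn_iff isOpen_Ioi.isLocallyClosed]
    intro C hC0 hC
    obtain ⟨m, hm⟩ := exists_mem_exhIcc hC continuousOn_id hC0
    exact (hu m).mono_set hm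
  refine ⟨hlocal hfint, hlocal fun m => integrable_finsetSum _ fun j _ => hdvint m j, ?_⟩
  intro φ hφ hφc hφs
  have hφ1 : ContDiff ℝ 1 φ := hφ.of_le (by exact_mod_cast le_top)
  obtain ⟨m', hm'⟩ := exists_mem_exhIcc hφc continuousOn_id hφs
  -- One step beyond the interval carrying the support of `φ`, so that `φ` vanishes at both
  -- endpoints of `exhIcc m` and integration by parts has no boundary term.
  set m := m' + 1 with hm
  have hends : ∀ t, t ∉ exhIcc m' → φ t = 0 := fun t ht => by
    by_contra h
    exact ht (hm' t (subset_tsupport _ h))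
  have h0 : ∀ t, t ∉ exhIcc m → φ t = 0 := fun t ht =>
    hends t fun h => ht (exhIcc_mono (Nat.le_succ m') h)
  have h0' : ∀ t, t ∉ exhIcc m → fderiv ℝ φ t 1 = 0 := fun t ht => by
    have h1 : t ∉ tsupport φ := fun h => ht (exhIcc_mono (Nat.le_succ m') (hm' t h))
    have h2 : fderiv ℝ φ t = 0 := by
      by_contra h
      exact h1 (tsupport_fderiv_subset ℝ (subset_tsupport _ h))
    simp [h2]
  have hsupp : ∀ u b : ℝ → ℝ, (∀ t, t ∉ exhIcc m → b t = 0) →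
      ∫ t in Ioi 0, u t * b t = ∫ t in exhIcc m, u t * b t := fun u b hb => by
    rw [← integral_indicator measurableSet_Ioi, ← integral_indicator (hmI m)]
    congr with t
    by_cases ht : t ∈ exhIcc m
    · simp [ht, exhIcc_subset_Ioi m ht]
    · by_cases ht' : t ∈ Ioi 0 <;> simp [ht, ht', hb t ht]
  rw [hsupp _ _ h0', hsupp _ _ h0]
  -- Over `exhIcc m` the curve stays in a single box `k`, so the box indicators drop out and one
  -- sequence `F k l` suffices.
  obtain ⟨k, hk⟩ := hbox m
  have hlim1 : Tendsto (fun l => ∫ t in exhIcc m, F k l (Φ p t) * fderiv ℝ φ t 1) atTop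
      (𝓝 (∫ t in exhIcc m, f (Φ p t) * fderiv ℝ φ t 1)) := by
    have hc : Continuous fun t => fderiv ℝ φ t 1 := hφ1.continuous_deriv le_rfl
    obtain ⟨c, hc'⟩ := (isCompact_exhIcc m).exists_bound_of_continuousOn hc.continuousOn
    refine tendsto_integral_mul_of_lintegral_enorm_sub (hmI m) (fun l => ?_) (hfint m) hc'
      hc.aestronglyMeasurable ?_
    · exact ((hF1 k l).continuous.comp_continuousOn
        (hΦc.mono (exhIcc_subset_Ioi m))).integrableOn_compact (isCompact_exhIcc m)
    · have := hcf m k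
      simpa only [hind _ hk] using this
  have hlim2 : Tendsto (fun l => ∫ t in exhIcc m,
        (∑ j, fderiv ℝ (F k l) (Φ p t) (Pi.single j 1) * v p t j) * φ t) atTop
      (𝓝 (∫ t in exhIcc m, (∑ j, d j (Φ p t) * v p t j) * φ t)) := by
    have hFint : ∀ l j, ContinuousOn (fun t => fderiv ℝ (F k l) (Φ p t) (Pi.single j 1))
        (exhIcc m) := fun l j =>
      (hFd k l j).comp_continuousOn (hΦc.mono (exhIcc_subset_Ioi m))
    have hvφ : ∀ j, ContinuousOn (fun t => v p t j * φ t) (exhIcc m) := fun j =>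
      (hvc m j).mul hφ1.continuous.continuousOn
    simp only [Finset.sum_mul, mul_assoc]
    have e1 : ∀ l, ∫ t in exhIcc m, ∑ j, fderiv ℝ (F k l) (Φ p t) (Pi.single j 1) *
        (v p t j * φ t) = ∑ j, ∫ t in exhIcc m, fderiv ℝ (F k l) (Φ p t) (Pi.single j 1) *
        (v p t j * φ t) := fun l => integral_finsetSum _ fun j _ =>
      ((hFint l j).mul (hvφ j)).integrableOn_compact (isCompact_exhIcc m)
    simp only [e1]
    rw [integral_finsetSum _ fun j _ => (hdint j m).mul_continuousOn (hvφ j) (isCompact_exhIcc m)]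
    refine tendsto_finsetSum _ fun j _ => ?_
    obtain ⟨c, hc'⟩ := (isCompact_exhIcc m).exists_bound_of_continuousOn (hvφ j)
    refine tendsto_integral_mul_of_lintegral_enorm_sub (hmI m)
      (fun l => (hFint l j).integrableOn_compact (isCompact_exhIcc m)) (hdint j m) hc'
      ((hvφ j).aestronglyMeasurable (hmI m)) ?_
    have := hcd j m k
    simpa only [hind _ hk] using this
  refine tendsto_nhds_unique hlim1 ?_
  refine (hlim2.neg).congr fun l => (integral_mul_deriv_eq_neg_of_vanish ?_ ?_ ?_ hφ1 ?_ ?_).symm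
  · have : (0 : ℝ) ≤ m := m.cast_nonneg
    refine le_trans ?_ (by linarith : (1 : ℝ) ≤ m + 1)
    rw [div_le_one (by positivity)]
    linarith
  · intro t ht
    have h1 := ((hF1' k l).differentiable one_ne_zero (Φ p t)).hasFDerivAt.comp_hasDerivAt t
      (hpd t (exhIcc_subset_Ioi m ht))
    refine h1.congr_deriv ?_
    conv_lhs => rw [← Finset.univ_sum_single (v p t)]
    rw [map_sum]
    refine Finset.sum_congr rfl fun j _ => ?_
    rw [show (Pi.single j (v p t j) : Fin n → ℝ) = v p t j • Pi.single j 1 by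
      rw [← Pi.single_smul]; simp, map_smul, smul_eq_mul, mul_comm]
  · exact continuousOn_finsetSum _ fun j _ =>
      ((hFd k l j).comp_continuousOn (hΦc.mono (exhIcc_subset_Ioi m))).mul (hvc m j)
  · refine hends _ fun h => ?_
    have := h.1
    rw [hm] at this
    push_cast at this
    rw [div_le_div_iff_of_pos_left one_pos (by positivity) (by positivity)] at this
    linarith
  · refine hends _ fun h => ?_
    have := h.2
    rw [hm] at this
    push_cast at this
    linarith

end Curves

/-! ### Weak Leibniz rule for multiplication by an affine function -/

section WeakProduct

lemma LocallyIntegrableOn.integrableOn_mul_of_tsupport {h ψ : ℝ → ℝ}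
    (hh : LocallyIntegrableOn h (Ioi 0)) (hψ : Continuous ψ) (hψc : HasCompactSupport ψ)
    (hψs : tsupport ψ ⊆ Ioi 0) : IntegrableOn (fun t => h t * ψ t) (Ioi 0) := by
  have h1 : IntegrableOn (fun t => h t * ψ t) (tsupport ψ) :=
    (hh.integrableOn_compact_subset hψs hψc).mul_continuousOn hψ.continuousOn hψc
  refine h1.of_forall_sdiff_eq_zero measurableSet_Ioi fun t ht => ?_
  rw [image_eq_zero_of_notMem_tsupport ht.2, mul_zero]

/-- The factor `t + c` is moved onto the test function. With `c` the sum of the other coordinates,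
it is the coordinate sum along a coordinate line. -/
lemma HasWeakDirDeriv.add_const_mul {h d : ℝ → ℝ} (hd : HasWeakDirDeriv (Ioi 0) h 1 d) (c : ℝ) :
    HasWeakDirDeriv (Ioi 0) (fun t => (t + c) * h t) 1 fun t => h t + (t + c) * d t := by
  have hc : ContinuousOn (fun t : ℝ => t + c) (Ioi 0) := by fun_prop
  have hmul : ∀ {u : ℝ → ℝ}, LocallyIntegrableOn u (Ioi 0) →
      LocallyIntegrableOn (fun t => (t + c) * u t) (Ioi 0) := fun hu =>
    hu.continuousOn_mul hc isOpen_Ioi.isLocallyClosed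
  refine ⟨hmul hd.1, hd.1.add (hmul hd.2.1), fun φ hφ hφc hφs => ?_⟩
  have hψs : tsupport (fun t => (t + c) * φ t) ⊆ tsupport φ := tsupport_mul_subset_right
  have hfd : ∀ t, fderiv ℝ (fun t => (t + c) * φ t) t 1 = φ t + (t + c) * fderiv ℝ φ t 1 := by
    intro t
    have h1 : HasDerivAt φ (fderiv ℝ φ t 1) t :=
      (hφ.differentiable (by simp) t).hasDerivAt
    have h2 := ((hasDerivAt_id t).add_const c).mul h1
    have h3 : fderiv ℝ (fun t => (t + c) * φ t) t 1 = deriv (fun t => (t + c) * φ t) t := rfl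
    rw [h3]
    refine h2.deriv.trans ?_
    simp
  have hφd : Continuous fun t => fderiv ℝ φ t 1 :=
    (hφ.of_le (by exact_mod_cast le_top) : ContDiff ℝ 1 φ).continuous_deriv le_rfl
  have hφdc : HasCompactSupport fun t => fderiv ℝ φ t 1 := hφc.fderiv_apply ℝ 1
  have hφds : tsupport (fun t => fderiv ℝ φ t 1) ⊆ tsupport φ :=
    (tsupport_fderiv_apply_subset ℝ 1)
  have key := hd.2.2 (fun t => (t + c) * φ t) (by fun_prop) (hφc.mul_left) (hψs.trans hφs)
  simp only [hfd, mul_add] at key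
  have i1 := LocallyIntegrableOn.integrableOn_mul_of_tsupport hd.1 hφ.continuous hφc hφs
  have i2 := LocallyIntegrableOn.integrableOn_mul_of_tsupport (hmul hd.1) hφd hφdc
    (hφds.trans hφs)
  have i3 := LocallyIntegrableOn.integrableOn_mul_of_tsupport (hmul hd.2.1) hφ.continuous hφc hφs
  have e2 : ∀ t, h t * ((t + c) * fderiv ℝ φ t 1) = (t + c) * h t * fderiv ℝ φ t 1 :=
    fun t => by ring
  have e3 : ∀ t, d t * ((t + c) * φ t) = (t + c) * d t * φ t := fun t => by ring
  simp only [e2, e3] at key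
  rw [integral_add i1 i2] at key
  simp only [add_mul (h _)]
  rw [integral_add i1 i3]
  linarith

end WeakProduct

/-! ### Radial and tangential parts of the energy -/

section Direction

variable {n : ℕ}

/-- The derivative along the ray through `x`, at the point of this ray with coordinate sum `t`. -/
noncomputable def radDeriv (d : Fin n → (Fin n → ℝ) → ℝ) (t : ℝ) (x : Fin n → ℝ) : ℝ :=
  ∑ j, (x j / ∑ i, x i) * d j ((t / ∑ i, x i) • x)

/-- The part of the energy carried by directions along which the coordinate sum is constant, at
the point with coordinate sum `t` of the ray through `x`. -/
noncomputable def tanEnergy (d : Fin n → (Fin n → ℝ) → ℝ) (t : ℝ) (x : Fin n → ℝ) : ℝ :=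
  ∑ i, (x i / ∑ i, x i) * (d i ((t / ∑ i, x i) • x) - radDeriv d t x) ^ 2

lemma sum_smul_apply (r : ℝ) (x : Fin n → ℝ) : ∑ i, (r • x) i = r * ∑ i, x i := by
  simp [Finset.mul_sum]

lemma div_sum_smul_smul {r : ℝ} (hr : r ≠ 0) (t : ℝ) (x : Fin n → ℝ) :
    (t / ∑ i, (r • x) i) • (r • x) = (t / ∑ i, x i) • x := by
  rw [sum_smul_apply, smul_smul]
  congr 1
  field_simp

lemma radDeriv_smul (d : Fin n → (Fin n → ℝ) → ℝ) {r : ℝ} (hr : r ≠ 0) (t : ℝ) (x : Fin n → ℝ) :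
    radDeriv d t (r • x) = radDeriv d t x := by
  simp only [radDeriv, div_sum_smul_smul hr]
  simp only [sum_smul_apply]
  simp only [Pi.smul_apply, smul_eq_mul, mul_div_mul_left _ _ hr]

lemma tanEnergy_smul (d : Fin n → (Fin n → ℝ) → ℝ) {r : ℝ} (hr : r ≠ 0) (t : ℝ) (x : Fin n → ℝ) :
    tanEnergy d t (r • x) = tanEnergy d t x := by
  simp only [tanEnergy, div_sum_smul_smul hr, radDeriv_smul d hr]
  simp only [sum_smul_apply]
  simp only [Pi.smul_apply, smul_eq_mul, mul_div_mul_left _ _ hr]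

lemma tanEnergy_nonneg (d : Fin n → (Fin n → ℝ) → ℝ) (t : ℝ) {x : Fin n → ℝ}
    (hx : x ∈ posOrthant n) : 0 ≤ tanEnergy d t x :=
  Finset.sum_nonneg fun i _ => mul_nonneg
    (div_nonneg (hx i).le (Finset.sum_nonneg fun j _ => (hx j).le)) (sq_nonneg _)

lemma sum_div_sum_eq_one {x : Fin n → ℝ} (hx : ∑ i, x i ≠ 0) : ∑ i, x i / ∑ j, x j = 1 := by
  rw [← Finset.sum_div, div_self hx]

lemma sum_mul_sub_radDeriv_eq_zero (d : Fin n → (Fin n → ℝ) → ℝ) (t : ℝ) {x : Fin n → ℝ}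
    (hx : ∑ i, x i ≠ 0) :
    ∑ i, (x i / ∑ i, x i) * (d i ((t / ∑ i, x i) • x) - radDeriv d t x) = 0 := by
  simp only [mul_sub, Finset.sum_sub_distrib]
  rw [← Finset.sum_mul, sum_div_sum_eq_one hx, one_mul, radDeriv, sub_self]

/-- The weights `x i / ∑ x j` sum to one and the deviations from `radDeriv` have weighted mean zero,
so the cross term vanishes. Taking `b = radDeriv`, `c = 1` splits the energy; taking `b = F x`, `c =
t` computes the energy of `G`. -/
lemma sum_mul_add_sq (d : Fin n → (Fin n → ℝ) → ℝ) (t b c : ℝ) {x : Fin n → ℝ}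
    (hx : ∑ i, x i ≠ 0) :
    ∑ i, (x i / ∑ i, x i) * (b + c * (d i ((t / ∑ i, x i) • x) - radDeriv d t x)) ^ 2 =
      b ^ 2 + c ^ 2 * tanEnergy d t x := by
  have h0 := sum_mul_sub_radDeriv_eq_zero d t hx
  have h1 := sum_div_sum_eq_one hx
  calc _ = ∑ i, ((x i / ∑ i, x i) * b ^ 2 +
        2 * b * c * ((x i / ∑ i, x i) * (d i ((t / ∑ i, x i) • x) - radDeriv d t x)) +
        c ^ 2 * ((x i / ∑ i, x i) * (d i ((t / ∑ i, x i) • x) - radDeriv d t x) ^ 2)) :=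
        Finset.sum_congr rfl fun i _ => by ring
    _ = _ := by
      rw [Finset.sum_add_distrib, Finset.sum_add_distrib, ← Finset.sum_mul, ← Finset.mul_sum,
        ← Finset.mul_sum, h0, h1, tanEnergy]
      ring

lemma sum_mul_sq_eq (d : Fin n → (Fin n → ℝ) → ℝ) (t : ℝ) {x : Fin n → ℝ} (hx : ∑ i, x i ≠ 0) :
    ∑ i, (x i / ∑ i, x i) * d i ((t / ∑ i, x i) • x) ^ 2 =
      radDeriv d t x ^ 2 + tanEnergy d t x := by
  have := sum_mul_add_sq d t (radDeriv d t x) 1 hx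
  simpa using this

lemma measurable_radDeriv {d : Fin n → (Fin n → ℝ) → ℝ} (hd : ∀ i, Measurable (d i)) :
    Measurable fun z : ℝ × (Fin n → ℝ) => radDeriv d z.1 z.2 := by
  have : Measurable fun z : ℝ × (Fin n → ℝ) => (z.1 / ∑ i, z.2 i) • z.2 := by fun_prop
  unfold radDeriv
  exact Finset.measurable_fun_sum _ fun i _ => (by fun_prop : Measurable fun z :
    ℝ × (Fin n → ℝ) => z.2 i / ∑ j, z.2 j).mul ((hd i).comp this)

lemma measurable_tanEnergy {d : Fin n → (Fin n → ℝ) → ℝ} (hd : ∀ i, Measurable (d i)) :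
    Measurable fun z : ℝ × (Fin n → ℝ) => tanEnergy d z.1 z.2 := by
  have h1 : Measurable fun z : ℝ × (Fin n → ℝ) => (z.1 / ∑ i, z.2 i) • z.2 := by fun_prop
  have h2 := measurable_radDeriv hd
  unfold tanEnergy
  exact Finset.measurable_fun_sum _ fun i _ => (by fun_prop : Measurable fun z :
    ℝ × (Fin n → ℝ) => z.2 i / ∑ j, z.2 j).mul ((((hd i).comp h1).sub h2).pow_const 2)

end Direction

/-! ### Independence of the coordinate sum and 0-homogeneous functions -/

section Homogeneous

open ProbabilityTheory

variable {n : ℕ} {α : Fin n → ℝ}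

lemma ae_mem_posOrthant (hα : ∀ i, 0 < α i) :
    ∀ᵐ x ∂(Measure.pi fun i => gammaMeasure (α i) 1), x ∈ posOrthant n := by
  have := fun i => isProbabilityMeasure_gammaMeasure (hα i) one_pos
  refine ae_all_iff.2 fun i => ?_
  exact (Measure.quasiMeasurePreserving_eval (fun i => gammaMeasure (α i) 1) i).ae
    (ae_pos_gammaMeasure (a := α i))

lemma ae_polar (hn : 1 ≤ n) (hα : ∀ i, 0 < α i) {a : ℝ} (ha : 0 < a) :
    ∀ᵐ z ∂((gammaMeasure a 1).prod (Measure.pi fun i => gammaMeasure (α i) 1)),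
      0 < z.1 ∧ z.2 ∈ posOrthant n ∧ 0 < ∑ i, z.2 i := by
  have := isProbabilityMeasure_gammaMeasure ha one_pos
  have := isProbabilityMeasure_pi_gammaMeasure hα
  filter_upwards [Measure.quasiMeasurePreserving_fst.ae (ae_pos_gammaMeasure (a := a)),
    Measure.quasiMeasurePreserving_snd.ae (ae_mem_posOrthant hα)] with z h1 h2
  exact ⟨h1, h2, sum_pos_of_mem_posOrthant hn h2⟩

/-- The polar map has coordinate sum `t` and keeps the direction of `x`, so under it the integrand
splits into a function of `t` and a function of `x`. -/
lemma lintegral_mul_homogeneous (hn : 1 ≤ n) (hα : ∀ i, 0 < α i) {w : ℝ → ℝ≥0∞}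
    (hw : Measurable w) {W : (Fin n → ℝ) → ℝ≥0∞} (hW : Measurable W)
    (hhom : ∀ (r : ℝ) x, r ≠ 0 → W (r • x) = W x) :
    ∫⁻ x, w (∑ i, x i) * W x ∂(Measure.pi fun i => gammaMeasure (α i) 1) =
      (∫⁻ t, w t ∂(gammaMeasure (∑ i, α i) 1)) *
        ∫⁻ x, W x ∂(Measure.pi fun i => gammaMeasure (α i) 1) := by
  have hA : 0 < ∑ i, α i := Finset.sum_pos (fun i _ => hα i) ⟨⟨0, hn⟩, Finset.mem_univ _⟩
  have := isProbabilityMeasure_pi_gammaMeasure hα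
  rw [← (measurePreserving_polar_gammaMeasure hn hα).lintegral_comp (by fun_prop),
    ← lintegral_prod_mul hw.aemeasurable hW.aemeasurable]
  refine lintegral_congr_ae ?_
  filter_upwards [ae_polar hn hα hA] with z hz
  have hs := hz.2.2.ne'
  rw [sum_smul_apply, div_mul_cancel₀ _ hs, hhom _ _ (div_ne_zero hz.1.ne' hs)]

lemma integral_sum_mul_homogeneous (hn : 1 ≤ n) (hα : ∀ i, 0 < α i) {W : (Fin n → ℝ) → ℝ}
    (hW : Measurable W) (hhom : ∀ (r : ℝ) x, r ≠ 0 → W (r • x) = W x) :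
    ∫ x, (∑ i, x i) * W x ∂(Measure.pi fun i => gammaMeasure (α i) 1) =
      (∑ i, α i) * ∫ x, W x ∂(Measure.pi fun i => gammaMeasure (α i) 1) := by
  have hA : 0 < ∑ i, α i := Finset.sum_pos (fun i _ => hα i) ⟨⟨0, hn⟩, Finset.mem_univ _⟩
  have h1 := isProbabilityMeasure_pi_gammaMeasure hα
  have h2 := isProbabilityMeasure_gammaMeasure hA one_pos
  have hp := measurePreserving_polar_gammaMeasure hn hα
  conv_lhs => rw [← hp.map_eq]
  rw [integral_map hp.measurable.aemeasurable (by fun_prop)]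
  conv_rhs => rw [← integral_id_gammaMeasure hA]
  rw [← integral_prod_mul]
  refine integral_congr_ae ?_
  filter_upwards [ae_polar hn hα hA] with z hz
  have hs := hz.2.2.ne'
  rw [sum_smul_apply, div_mul_cancel₀ _ hs, hhom _ _ (div_ne_zero hz.1.ne' hs)]

end Homogeneous

/-! ### Weak derivatives depend only on almost everywhere classes -/

section WeakCongr

open Topology

lemma LocallyIntegrableOn.congr_ae_restrict {E : Type*} [TopologicalSpace E] [MeasureSpace E] {Ω : Set E} {f g : E → ℝ}
    (hf : LocallyIntegrableOn f Ω) (h : f =ᵐ[volume.restrict Ω] g) : LocallyIntegrableOn g Ω := by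
  intro x hx
  obtain ⟨t, ht, hft⟩ := hf x hx
  refine ⟨t ∩ Ω, Filter.inter_mem ht self_mem_nhdsWithin, ?_⟩
  exact (hft.mono_set inter_subset_left).congr_fun_ae
    (ae_restrict_of_ae_restrict_of_subset inter_subset_right h)

variable {E : Type*} [NormedAddCommGroup E] [NormedSpace ℝ E] [MeasureSpace E]

lemma HasWeakDirDeriv.congr_ae {Ω : Set E} {f g d e : E → ℝ} {v : E} (h : HasWeakDirDeriv Ω f v d)
    (hf : f =ᵐ[volume.restrict Ω] g) (hd : d =ᵐ[volume.restrict Ω] e) :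
    HasWeakDirDeriv Ω g v e := by
  refine ⟨LocallyIntegrableOn.congr_ae_restrict h.1 hf,
    LocallyIntegrableOn.congr_ae_restrict h.2.1 hd, fun φ hφ hφc hφs => ?_⟩
  have := h.2.2 φ hφ hφc hφs
  rw [integral_congr_ae (g := fun x => g x * fderiv ℝ φ x v)
    (by filter_upwards [hf] with x hx; rw [hx]),
    integral_congr_ae (f := fun x => d x * φ x) (g := fun x => e x * φ x)
    (by filter_upwards [hd] with x hx; rw [hx])] at this
  exact this

lemma HasWeakDirDeriv.congr_eqOn {Ω : Set E} (hΩ : MeasurableSet Ω) {f g d e : E → ℝ} {v : E}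
    (h : HasWeakDirDeriv Ω f v d) (hf : EqOn f g Ω) (hd : EqOn d e Ω) : HasWeakDirDeriv Ω g v e :=
  h.congr_ae (by filter_upwards [ae_restrict_mem hΩ] with x hx using hf hx)
    (by filter_upwards [ae_restrict_mem hΩ] with x hx using hd hx)

end WeakCongr

/-! ### Poincaré inequality for the Dirichlet law -/

section DirichletPoincare

open ProbabilityTheory

variable {n : ℕ} {α : Fin n → ℝ} {f : (Fin n → ℝ) → ℝ} {d : Fin n → (Fin n → ℝ) → ℝ}

lemma hasDerivAt_polar_update (i : Fin n) (σ t : ℝ) (x : Fin n → ℝ)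
    (hs : ∑ j, Function.update x i t j ≠ 0) :
    HasDerivAt (fun t => (σ / ∑ j, Function.update x i t j) • Function.update x i t)
      ((σ / ∑ j, Function.update x i t j) • (Pi.single i 1 : Fin n → ℝ) -
        (σ / (∑ j, Function.update x i t j) ^ 2) • Function.update x i t) t := by
  have h1 : HasDerivAt (fun t => Function.update x i t) (Pi.single i 1 : Fin n → ℝ) t :=
    hasDerivAt_update x i t
  have h2 : HasDerivAt (fun t => ∑ j, Function.update x i t j) 1 t := by
    have := HasDerivAt.fun_sum (u := Finset.univ) fun j _ => (hasDerivAt_pi.1 h1) j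
    simpa using this
  have h3 := ((hasDerivAt_const t σ).div h2 hs).smul h1
  refine h3.congr_deriv ?_
  simp only [Pi.div_apply, zero_mul, mul_one, zero_sub, neg_div, neg_smul]
  rw [sub_eq_add_neg]

lemma update_mem_posOrthant {x : Fin n → ℝ} (hx : x ∈ posOrthant n) (i : Fin n) {t : ℝ}
    (ht : 0 < t) : Function.update x i t ∈ posOrthant n := fun j => by
  by_cases hj : j = i
  · subst hj; simpa using ht
  · simpa [hj] using hx j

lemma ae_hasWeakDirDeriv_update (hn : 1 ≤ n) (hα : ∀ i, 0 < α i) (hfm : Measurable f)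
    (hdm : ∀ i, Measurable (d i))
    (hd : ∀ i, HasWeakDirDeriv (posOrthant n) f (Pi.single i 1) (d i)) (i : Fin n) :
    ∀ᵐ z ∂((gammaMeasure (∑ i, α i) 1).prod (Measure.pi fun i => gammaMeasure (α i) 1)),
      HasWeakDirDeriv (Ioi 0)
        (fun t => (∑ j, Function.update z.2 i t j) *
          f ((z.1 / ∑ j, Function.update z.2 i t j) • Function.update z.2 i t)) 1
        (fun t => f ((z.1 / ∑ j, Function.update z.2 i t j) • Function.update z.2 i t) +
          z.1 * (d i ((z.1 / ∑ j, Function.update z.2 i t j) • Function.update z.2 i t) -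
            radDeriv d z.1 (Function.update z.2 i t))) := by
  have hA : 0 < ∑ i, α i := Finset.sum_pos (fun i _ => hα i) ⟨⟨0, hn⟩, Finset.mem_univ _⟩
  have h1 := isProbabilityMeasure_pi_gammaMeasure hα
  have h2 := isProbabilityMeasure_gammaMeasure hA one_pos
  have h3 := fun i => isProbabilityMeasure_gammaMeasure (hα i) one_pos
  set γA := gammaMeasure (∑ i, α i) 1
  set γn := Measure.pi fun i => gammaMeasure (α i) 1
  -- Resampling coordinate `i` and then replacing the radius by an independent Gamma(`∑ α i`)
  -- variable both preserve the product law. The auxiliary Gamma radius is there so that the curves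
  -- sweep out that law.
  have hmp : MeasurePreserving (fun z : (ℝ × (Fin n → ℝ)) × ℝ =>
      (z.1.1 / ∑ j, Function.update z.1.2 i z.2 j) • Function.update z.1.2 i z.2)
      ((γA.prod γn).prod (gammaMeasure (α i) 1)) γn := by
    have hu := measurePreserving_update (fun i => gammaMeasure (α i) 1) i
    have hp := (MeasurePreserving.id γA).prod hu
    exact (measurePreserving_polar_gammaMeasure hn hα).comp
      (hp.comp (measurePreserving_prodAssoc γA γn (gammaMeasure (α i) 1)))
  have hpos := ae_polar hn hα hA
  have hspos : ∀ {x : Fin n → ℝ} {t : ℝ}, x ∈ posOrthant n → 0 < t →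
      0 < ∑ j, Function.update x i t j := fun hx ht =>
    sum_pos_of_mem_posOrthant hn (update_mem_posOrthant hx i ht)
  have key := ae_hasWeakDirDeriv_comp hα (hα i)
    (Φ := fun (z : ℝ × (Fin n → ℝ)) t => (z.1 / ∑ j, Function.update z.2 i t j) • Function.update z.2 i t)
    (v := fun (z : ℝ × (Fin n → ℝ)) t => (z.1 / ∑ j, Function.update z.2 i t j) • (Pi.single i 1 : Fin n → ℝ) -
        (z.1 / (∑ j, Function.update z.2 i t j) ^ 2) • Function.update z.2 i t)
    hmp ?_ ?_ ?_ hfm hdm (hd i).1 hd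
  · filter_upwards [key, hpos] with z hz hzp
    have hsum : ∀ t, ∑ j, Function.update z.2 i t j = t + ∑ j ∈ Finset.univ \ {i}, z.2 j :=
      fun t => Finset.sum_update_of_mem (Finset.mem_univ i) _ _
    refine (hz.add_const_mul (∑ j ∈ Finset.univ \ {i}, z.2 j)).congr_eqOn measurableSet_Ioi ?_ ?_
    · intro t _
      simp only [hsum]
    · intro t ht
      have hs := (hspos hzp.2.1 ht).ne'
      simp only [← hsum]
      congr 1
      -- With `s` the coordinate sum of `y`, the derivative is `s * ((σ / s) * d i - (σ / s ^ 2) * ∑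
      -- y j * d j) = σ * (d i - radDeriv)`, where `σ = z.1`.
      set y := Function.update z.2 i t
      simp only [Pi.sub_apply, Pi.smul_apply, smul_eq_mul, mul_sub, Finset.sum_sub_distrib, radDeriv,
        Finset.mul_sum]
      congr 1
      · rw [Finset.sum_eq_single i (fun j _ hj => by simp [hj]) (by simp)]
        simp only [Pi.single_eq_same]
        field_simp
      · refine Finset.sum_congr rfl fun j _ => ?_
        field_simp
  · filter_upwards [hpos] with z hz t ht
    exact hasDerivAt_polar_update i z.1 t z.2 (hspos hz.2.1 ht).ne'
  · filter_upwards [hpos] with z hz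
    have hc : ContinuousOn (fun t => ∑ j, Function.update z.2 i t j) (Ioi 0) :=
      (continuous_finsetSum _ fun j _ => (continuous_apply j).comp
        (continuous_const.update i continuous_id)).continuousOn
    have hu : ContinuousOn (fun t => Function.update z.2 i t) (Ioi 0) :=
      (by fun_prop : Continuous fun t => Function.update z.2 i t).continuousOn
    have hne : ∀ t ∈ Ioi (0 : ℝ), ∑ j, Function.update z.2 i t j ≠ 0 := fun t ht =>
      (hspos hz.2.1 ht).ne'
    exact ((continuousOn_const.div hc hne).smul continuousOn_const).sub
      ((continuousOn_const.div (hc.pow 2) fun t ht => pow_ne_zero 2 (hne t ht)).smul hu)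
  · filter_upwards [hpos] with z hz t ht
    exact (smul_mem_posOrthant (div_pos hz.1 (hspos hz.2.1 ht))).2
      (update_mem_posOrthant hz.2.1 i ht)

/-- The Poincaré inequality for the Dirichlet distribution, with the optimal constant. -/
theorem ae_evariance_polar_le (hn : 1 ≤ n) (hα : ∀ i, 0 < α i) (hfm : Measurable f)
    (hdm : ∀ i, Measurable (d i))
    (hd : ∀ i, HasWeakDirDeriv (posOrthant n) f (Pi.single i 1) (d i)) :
    ∀ᵐ t ∂(gammaMeasure (∑ i, α i) 1),
      MemLp (fun x => f ((t / ∑ i, x i) • x)) 2 (Measure.pi fun i => gammaMeasure (α i) 1) →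
      ENNReal.ofReal (∑ i, α i) * evariance (fun x => f ((t / ∑ i, x i) • x))
          (Measure.pi fun i => gammaMeasure (α i) 1) ≤
        ∫⁻ x, ENNReal.ofReal (t ^ 2 * tanEnergy d t x)
          ∂(Measure.pi fun i => gammaMeasure (α i) 1) := by
  have hA : 0 < ∑ i, α i := Finset.sum_pos (fun i _ => hα i) ⟨⟨0, hn⟩, Finset.mem_univ _⟩
  have h1 := isProbabilityMeasure_pi_gammaMeasure hα
  have h2 := isProbabilityMeasure_gammaMeasure hA one_pos
  have h3 := fun i => isProbabilityMeasure_gammaMeasure (hα i) one_pos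
  set A := ∑ i, α i
  set γn := Measure.pi fun i => gammaMeasure (α i) 1
  have hall := Measure.ae_ae_of_ae_prod
    (ae_all_iff.2 fun i => ae_hasWeakDirDeriv_update hn hα hfm hdm hd i)
  filter_upwards [hall] with t ht hF2
  set F : (Fin n → ℝ) → ℝ := fun x => f ((t / ∑ i, x i) • x) with hF
  have hFm : Measurable F := hfm.comp (by fun_prop)
  have hFhom : ∀ (r : ℝ) x, r ≠ 0 → F (r • x) = F x := fun r x hr => by
    simp only [hF, div_sum_smul_smul hr]
  -- The 1-homogeneous extension of the direction function. Its `i`-th partial derivative `D i` has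
  -- degree zero, so the energy `∑ x i * D i ^ 2` is the coordinate sum times a function of the
  -- direction.
  let G : (Fin n → ℝ) → ℝ := fun x => (∑ i, x i) * F x
  have hGm : Measurable G := by fun_prop
  let D : Fin n → (Fin n → ℝ) → ℝ := fun i x =>
    F x + t * (d i ((t / ∑ i, x i) • x) - radDeriv d t x)
  have hDm : ∀ i, Measurable (D i) := fun i => by
    have e1 : Measurable fun x : Fin n → ℝ => d i ((t / ∑ i, x i) • x) :=
      (hdm i).comp (by fun_prop)
    have e2 : Measurable fun x : Fin n → ℝ => radDeriv d t x :=
      (measurable_radDeriv hdm).comp measurable_prodMk_left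
    exact hFm.add (measurable_const.mul (e1.sub e2))
  have hTm : Measurable fun x : Fin n → ℝ => tanEnergy d t x :=
    (measurable_tanEnergy hdm).comp measurable_prodMk_left
  set a2 := ∫ x, F x ^ 2 ∂γn with ha2
  have ha20 : 0 ≤ a2 := integral_nonneg fun x => sq_nonneg _
  have hF2l : ∫⁻ x, ENNReal.ofReal (F x ^ 2) ∂γn = ENNReal.ofReal a2 :=
    (ofReal_integral_eq_lintegral_ofReal hF2.integrable_sq (.of_forall fun _ => sq_nonneg _)).symm
  have hG2l : ∫⁻ x, ENNReal.ofReal (G x ^ 2) ∂γn = ENNReal.ofReal (A * (A + 1) * a2) := by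
    have e : ∀ x, ENNReal.ofReal (G x ^ 2) =
        ENNReal.ofReal ((∑ i, x i) ^ 2) * ENNReal.ofReal (F x ^ 2) := fun x => by
      rw [← ENNReal.ofReal_mul (sq_nonneg _), ← mul_pow]
    simp only [e]
    rw [lintegral_mul_homogeneous hn hα (w := fun s => ENNReal.ofReal (s ^ 2)) (by fun_prop)
      (W := fun x => ENNReal.ofReal (F x ^ 2)) (by fun_prop)
      (fun r x hr => by rw [hFhom r x hr]), lintegral_sq_gammaMeasure hA, hF2l,
      ← ENNReal.ofReal_mul (by positivity)]
  have hG2 : MemLp G 2 γn := (memLp_two_iff_lintegral hGm.aestronglyMeasurable).2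
    (hG2l ▸ ENNReal.ofReal_lt_top)
  have hGint : ∫ x, G x ∂γn = A * ∫ x, F x ∂γn := integral_sum_mul_homogeneous hn hα hFm hFhom
  have hG2i : ∫ x, G x ^ 2 ∂γn = A * (A + 1) * a2 := by
    rw [integral_eq_lintegral_of_nonneg_ae (.of_forall fun _ => sq_nonneg _) (by fun_prop), hG2l,
      ENNReal.toReal_ofReal (by positivity)]
  have hup : ∀ i, MeasurePreserving (fun z : (Fin n → ℝ) × ℝ => Function.update z.1 i z.2)
      (γn.prod (gammaMeasure (α i) 1)) γn := fun i =>
    measurePreserving_update (fun i => gammaMeasure (α i) 1) i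
  have hstep : ∀ i, ∫⁻ x, evariance (fun τ => G (Function.update x i τ)) (gammaMeasure (α i) 1) ∂γn
      ≤ ∫⁻ x, ENNReal.ofReal (x i * D i x ^ 2) ∂γn := fun i => by
    have hm : Measurable fun x : Fin n → ℝ => ENNReal.ofReal (x i * D i x ^ 2) := by
      have := hDm i
      fun_prop
    have hm' : Measurable fun z : (Fin n → ℝ) × ℝ => ENNReal.ofReal
        (Function.update z.1 i z.2 i * D i (Function.update z.1 i z.2) ^ 2) :=
      hm.comp (hup i).measurable
    rw [← (hup i).lintegral_comp hm, lintegral_prod _ hm'.aemeasurable]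
    refine lintegral_mono_ae ?_
    have hGu : MemLp (fun z : (Fin n → ℝ) × ℝ => G (Function.update z.1 i z.2)) 2
        (γn.prod (gammaMeasure (α i) 1)) := hG2.comp_measurePreserving (hup i)
    filter_upwards [ht, ae_memLp_two_prodMk_left (hGm.comp (hup i).measurable) hGu] with x hx hx2
    have := evariance_gammaMeasure_le (hα i)
      (h := fun τ => G (Function.update x i τ)) (d := fun τ => D i (Function.update x i τ))
      ((hDm i).comp (measurable_update x)) hx2 (hx i)
    simpa only [Function.update_self] using this
  have henergy : ∑ i, ∫⁻ x, ENNReal.ofReal (x i * D i x ^ 2) ∂γn =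
      ENNReal.ofReal A * (ENNReal.ofReal a2 + ∫⁻ x, ENNReal.ofReal (t ^ 2 * tanEnergy d t x) ∂γn) := by
    rw [← lintegral_finsetSum _ fun i _ => by have := hDm i; fun_prop]
    have e : ∫⁻ x, ∑ i, ENNReal.ofReal (x i * D i x ^ 2) ∂γn = ∫⁻ x, ENNReal.ofReal (∑ i, x i) *
        (ENNReal.ofReal (F x ^ 2) + ENNReal.ofReal (t ^ 2 * tanEnergy d t x)) ∂γn := by
      refine lintegral_congr_ae ?_
      filter_upwards [ae_mem_posOrthant hα] with x hx
      have hs := sum_pos_of_mem_posOrthant hn hx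
      rw [← ENNReal.ofReal_add (sq_nonneg _) (mul_nonneg (sq_nonneg _) (tanEnergy_nonneg d t hx)),
        ← ENNReal.ofReal_mul hs.le, ← sum_mul_add_sq d t (F x) t hs.ne', Finset.mul_sum,
        ENNReal.ofReal_sum_of_nonneg]
      · refine Finset.sum_congr rfl fun i _ => ?_
        congr 1
        rw [← mul_assoc, mul_div_cancel₀ _ hs.ne']
      · intro i _
        have := (hx i).le
        positivity
    rw [e, lintegral_mul_homogeneous hn hα (w := fun s => ENNReal.ofReal s) (by fun_prop)
      (W := fun x => ENNReal.ofReal (F x ^ 2) + ENNReal.ofReal (t ^ 2 * tanEnergy d t x))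
      (by fun_prop) (fun r x hr => by rw [hFhom r x hr, tanEnergy_smul d hr]),
      lintegral_id_gammaMeasure hA, lintegral_add_left (by fun_prop), hF2l]
  have hfinal := (evariance_pi_le (fun i => gammaMeasure (α i) 1) hGm hG2).trans
    ((Finset.sum_le_sum fun i _ => hstep i).trans henergy.le)
  -- With `m` the mean of `F` and `q` the tangential integral, this reads `A * (A + 1) * a2 - A ^ 2
  -- * m ^ 2 ≤ A * (a2 + q)`. The terms `A * a2` cancel, and dividing by `A` leaves `A * (a2 - m ^
  -- 2) ≤ q`.
  rw [evariance_eq_ofReal_sub hG2, hG2i, hGint] at hfinal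
  rw [evariance_eq_ofReal_sub hF2, ← ha2]
  rcases eq_or_ne (∫⁻ x, ENNReal.ofReal (t ^ 2 * tanEnergy d t x) ∂γn) ⊤ with hq | hq
  · rw [hq]
    exact le_top
  · lift (∫⁻ x, ENNReal.ofReal (t ^ 2 * tanEnergy d t x) ∂γn) to NNReal using hq with q
    rw [← ENNReal.ofReal_coe_nnreal, ← ENNReal.ofReal_add ha20 q.coe_nonneg, ← ENNReal.ofReal_mul hA.le,
      ENNReal.ofReal_le_ofReal_iff (mul_nonneg hA.le (add_nonneg ha20 q.coe_nonneg))] at hfinal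
    rw [← ENNReal.ofReal_coe_nnreal, ← ENNReal.ofReal_mul hA.le]
    refine ENNReal.ofReal_le_ofReal (le_of_mul_le_mul_left ?_ hA)
    linarith

end DirichletPoincare

/-! ### Assembly of the radial and tangential estimates -/

section Liouville

open ProbabilityTheory Filter Topology

/-- The Dirichlet inequality is known for almost every Gamma-distributed radius. The positive Gamma
density turns this into Lebesgue-almost every radius, hence almost every radius for `radialLaw`. -/
lemma ae_restrict_of_ae_gammaMeasure {a : ℝ} (ha : 0 < a) {p : ℝ → Prop}
    (h : ∀ᵐ x ∂(gammaMeasure a 1), p x) : ∀ᵐ x ∂(volume : Measure ℝ).restrict (Ioi 0), p x := by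
  rw [gammaMeasure, ae_withDensity_iff
    (show Measurable (gammaPDF a 1) from (measurable_gammaPDFReal a 1).ennreal_ofReal)] at h
  rw [ae_restrict_iff' measurableSet_Ioi]
  filter_upwards [h] with x hx h0
  refine hx ?_
  rw [gammaPDF, Ne, ENNReal.ofReal_eq_zero, not_le]
  exact gammaPDFReal_pos ha one_pos h0

lemma ae_pos_radialLaw {n : ℕ} {α : Fin n → ℝ} {g : ℝ → ℝ} : ∀ᵐ t ∂(radialLaw α g), 0 < t :=
  (lawPropTo_absolutelyContinuous _ _).ae_le (ae_restrict_mem measurableSet_Ioi)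

/-- Passage to the limit along constants tending to the infimum, which need not be attained.
Finiteness of `X` is needed because the infimum could be zero and `0 * ⊤ = 0`. -/
lemma le_ofReal_sInf_mul_add {S : Set ℝ} (hS : S.Nonempty) (hS0 : BddBelow S) {V X R : ℝ≥0∞}
    (hX : X ≠ ⊤) (h : ∀ c ∈ S, V ≤ ENNReal.ofReal c * X + R) :
    V ≤ ENNReal.ofReal (sInf S) * X + R := by
  obtain ⟨u, -, hu, huS⟩ := exists_seq_tendsto_sInf hS hS0
  have ht : Tendsto (fun k => ENNReal.ofReal (u k) * X + R) atTop
      (𝓝 (ENNReal.ofReal (sInf S) * X + R)) :=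
    (ENNReal.Tendsto.mul_const (ENNReal.tendsto_ofReal hu) (Or.inr hX)).add tendsto_const_nhds
  exact ge_of_tendsto' ht fun k => h _ (huS k)

variable {n : ℕ} {α : Fin n → ℝ} {g w : ℝ → ℝ} {f : (Fin n → ℝ) → ℝ}
  {d : Fin n → (Fin n → ℝ) → ℝ}

lemma ae_hasWeakDirDeriv_ray (hn : 1 ≤ n) (hα : ∀ i, 0 < α i) (hfm : Measurable f)
    (hdm : ∀ i, Measurable (d i))
    (hd : ∀ i, HasWeakDirDeriv (posOrthant n) f (Pi.single i 1) (d i)) :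
    ∀ᵐ x ∂(Measure.pi fun i => gammaMeasure (α i) 1),
      HasWeakDirDeriv (Ioi 0) (fun t => f ((t / ∑ i, x i) • x)) 1 fun t => radDeriv d t x := by
  have hA : 0 < ∑ i, α i := Finset.sum_pos (fun i _ => hα i) ⟨⟨0, hn⟩, Finset.mem_univ _⟩
  have h1 := isProbabilityMeasure_pi_gammaMeasure hα
  have h2 := isProbabilityMeasure_gammaMeasure hA one_pos
  have key := ae_hasWeakDirDeriv_comp hα hA
    (Φ := fun (x : Fin n → ℝ) t => (t / ∑ i, x i) • x) (v := fun x _ => (1 / ∑ i, x i) • x)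
    ((measurePreserving_polar_gammaMeasure hn hα).comp Measure.measurePreserving_swap)
    (.of_forall fun x t _ => ((hasDerivAt_id t).div_const _).smul_const x)
    (.of_forall fun x => continuousOn_const)
    ((ae_mem_posOrthant hα).mono fun x hx t ht =>
      (smul_mem_posOrthant (div_pos ht (sum_pos_of_mem_posOrthant hn hx))).2 hx)
    hfm hdm (hd ⟨0, hn⟩).1 hd
  filter_upwards [key] with x hx
  refine hx.congr_eqOn measurableSet_Ioi (fun t _ => rfl) fun t _ => ?_
  refine Finset.sum_congr rfl fun j _ => ?_
  simp only [Pi.smul_apply, smul_eq_mul]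
  ring

/-- In polar coordinates the integrand is `w t` times a weighted second moment of the `d i`, which
splits into squared mean and variance. -/
lemma lintegral_energy_eq (hn : 1 ≤ n) (hα : ∀ i, 0 < α i) (hg : Measurable g)
    (hμ : IsProbabilityMeasure (liouvilleLaw α g)) (hw : Measurable w)
    (hw0 : ∀ s, 0 < s → 0 < w s) (hdm : ∀ i, Measurable (d i)) :
    ∫⁻ x, ENNReal.ofReal (w (∑ i, x i) / (∑ i, x i) * ∑ i, x i * d i x ^ 2) ∂(liouvilleLaw α g) =
      ∫⁻ x, ∫⁻ t, ENNReal.ofReal (w t * radDeriv d t x ^ 2) ∂(radialLaw α g)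
          ∂(Measure.pi fun i => gammaMeasure (α i) 1) +
        ∫⁻ t, ∫⁻ x, ENNReal.ofReal (w t * tanEnergy d t x)
          ∂(Measure.pi fun i => gammaMeasure (α i) 1) ∂(radialLaw α g) := by
  obtain ⟨hS, hpol⟩ := measurePreserving_polar hn hα hg hμ
  have hγ := isProbabilityMeasure_pi_gammaMeasure hα
  have hr := measurable_radDeriv hdm
  have ht := measurable_tanEnergy hdm
  have hrm : Measurable fun z : ℝ × (Fin n → ℝ) =>
    ENNReal.ofReal (w z.1 * radDeriv d z.1 z.2 ^ 2) := by fun_prop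
  have htm : Measurable fun z : ℝ × (Fin n → ℝ) =>
    ENNReal.ofReal (w z.1 * tanEnergy d z.1 z.2) := by fun_prop
  rw [← hpol.lintegral_comp (by fun_prop), ← lintegral_prod_symm _ hrm.aemeasurable,
    ← lintegral_prod _ htm.aemeasurable, ← lintegral_add_left hrm]
  refine lintegral_congr_ae ?_
  filter_upwards [Measure.quasiMeasurePreserving_fst.ae (ae_pos_radialLaw (α := α) (g := g)),
    Measure.quasiMeasurePreserving_snd.ae (ae_mem_posOrthant hα)] with z hz1 hz2
  have hs := sum_pos_of_mem_posOrthant hn hz2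
  have hwz := hw0 _ hz1
  rw [← ENNReal.ofReal_add (by positivity) (mul_nonneg hwz.le (tanEnergy_nonneg d z.1 hz2)),
    ← mul_add, ← sum_mul_sq_eq d z.1 hs.ne', sum_smul_apply, div_mul_cancel₀ _ hs.ne',
    Finset.mul_sum, Finset.mul_sum]
  congr 1
  refine Finset.sum_congr rfl fun i _ => ?_
  simp only [Pi.smul_apply, smul_eq_mul]
  field_simp

lemma evariance_liouvilleLaw_le_of_measurable (hn : 1 ≤ n) (hα : ∀ i, 0 < α i) (hg : Measurable g)
    (hμ : IsProbabilityMeasure (liouvilleLaw α g)) (hw : Measurable w)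
    (hw0 : ∀ s, 0 < s → 0 < w s) (hP : ∃ C : ℝ, WeightedPoincare (radialLaw α g) w C)
    (hfm : Measurable f) (hf : MemLp f 2 (liouvilleLaw α g)) (hdm : ∀ i, Measurable (d i))
    (hd : ∀ i, HasWeakDirDeriv (posOrthant n) f (Pi.single i 1) (d i)) :
    evariance f (liouvilleLaw α g) ≤
      max (ENNReal.ofReal (poincareConst (radialLaw α g) w))
          ((∫⁻ s, ENNReal.ofReal (s ^ 2 / w s) ∂(radialLaw α g)) / ENNReal.ofReal (∑ i, α i)) *
        ∫⁻ x, ENNReal.ofReal (w (∑ i, x i) / (∑ i, x i) * ∑ i, x i * d i x ^ 2)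
          ∂(liouvilleLaw α g) := by
  have hA : 0 < ∑ i, α i := Finset.sum_pos (fun i _ => hα i) ⟨⟨0, hn⟩, Finset.mem_univ _⟩
  have hA' : ENNReal.ofReal (∑ i, α i) ≠ 0 := by simpa using hA
  obtain ⟨hS, hpol⟩ := measurePreserving_polar hn hα hg hμ
  have hγ := isProbabilityMeasure_pi_gammaMeasure hα
  rw [lintegral_energy_eq hn hα hg hμ hw hw0 hdm]
  have hacS : radialLaw α g ≪ volume.restrict (Ioi 0) := lawPropTo_absolutelyContinuous _ _
  have hpos := ae_pos_radialLaw (α := α) (g := g)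
  set ν := radialLaw α g
  set γn := Measure.pi fun i => gammaMeasure (α i) 1
  set K := ∫⁻ s, ENNReal.ofReal (s ^ 2 / w s) ∂ν with hK
  set X := ∫⁻ x, ∫⁻ t, ENNReal.ofReal (w t * radDeriv d t x ^ 2) ∂ν ∂γn with hX
  set Y := ∫⁻ t, ∫⁻ x, ENNReal.ofReal (w t * tanEnergy d t x) ∂γn ∂ν with hY
  have hhm : Measurable fun z : ℝ × (Fin n → ℝ) => f ((z.1 / ∑ i, z.2 i) • z.2) :=
    hfm.comp hpol.measurable
  have hh2 : MemLp (fun z : ℝ × (Fin n → ℝ) => f ((z.1 / ∑ i, z.2 i) • z.2)) 2 (ν.prod γn) :=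
    hf.comp_measurePreserving hpol
  have hradial : ∀ C, WeightedPoincare ν w C →
      ∫⁻ x, evariance (fun t => f ((t / ∑ i, x i) • x)) ν ∂γn ≤ ENNReal.ofReal C * X :=
    fun C hC => by
      rw [hX, ← lintegral_const_mul' _ _ ENNReal.ofReal_ne_top]
      refine lintegral_mono_ae ?_
      filter_upwards [ae_hasWeakDirDeriv_ray hn hα hfm hdm hd, ae_memLp_two_prodMk_right hhm hh2]
        with x hx hx2
      rw [evariance_eq_ofReal_sub hx2]
      exact hC.2 _ _ hx2 hx
  have htan : evariance (fun x => ∫ t, f ((t / ∑ i, x i) • x) ∂ν) γn ≤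
      K / ENNReal.ofReal (∑ i, α i) * Y := by
    -- The weights are dictated by the tangential energy: the Dirichlet bound carries a factor `t ^
    -- 2`, which `q = w t / t ^ 2` turns into the wanted `w t`, while `p = 1 / q` integrates to `K`.
    refine (evariance_integral_le hhm (hh2.integrable one_le_two)
      (p := fun t => ENNReal.ofReal (t ^ 2 / w t)) (q := fun t => ENNReal.ofReal (w t / t ^ 2))
      (by fun_prop) (by fun_prop) ?_).trans ?_
    · filter_upwards [hpos] with t ht
      have := hw0 t ht
      rw [← ENNReal.ofReal_mul (by positivity), ENNReal.one_le_ofReal]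
      apply le_of_eq
      field_simp
    · rw [ENNReal.div_eq_inv_mul, mul_right_comm, mul_comm]
      refine mul_le_mul_left ?_ K
      rw [hY, ← lintegral_const_mul' _ _ (ENNReal.inv_ne_top.2 hA')]
      refine lintegral_mono_ae ?_
      filter_upwards [hpos, ae_memLp_two_prodMk_left hhm hh2,
        hacS.ae_le (ae_restrict_of_ae_gammaMeasure hA
          (ae_evariance_polar_le hn hα hfm hdm hd))] with t ht ht2 htd
      have hwt := hw0 t ht
      have h1 := htd ht2
      have h2 : ∫⁻ x, ENNReal.ofReal (w t * tanEnergy d t x) ∂γn =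
          ENNReal.ofReal (w t / t ^ 2) * ∫⁻ x, ENNReal.ofReal (t ^ 2 * tanEnergy d t x) ∂γn := by
        rw [← lintegral_const_mul' _ _ ENNReal.ofReal_ne_top]
        refine lintegral_congr fun x => ?_
        rw [← ENNReal.ofReal_mul (by positivity)]
        congr 1
        field_simp
      rw [h2, mul_left_comm]
      refine mul_le_mul_right ?_ _
      rw [← ENNReal.div_eq_inv_mul, ENNReal.le_div_iff_mul_le (Or.inl hA')
        (Or.inl ENNReal.ofReal_ne_top), mul_comm]
      exact h1
  have htotal : ∀ C ∈ {C : ℝ | WeightedPoincare ν w C}, evariance f (liouvilleLaw α g) ≤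
      ENNReal.ofReal C * X + K / ENNReal.ofReal (∑ i, α i) * Y := fun C hC => by
    rw [← evariance_comp_of_measurePreserving hpol hfm]
    exact (evariance_prod_le hhm hh2).trans (add_le_add (hradial C hC) htan)
  -- Positivity of `K` makes the maximum nonzero, so an infinite radial energy makes the right-hand
  -- side infinite even if the Poincaré constant were zero.
  have hK0 : K / ENNReal.ofReal (∑ i, α i) ≠ 0 := by
    rw [Ne, ENNReal.div_eq_zero_iff, not_or]
    refine ⟨fun h => ?_, ENNReal.ofReal_ne_top⟩
    rw [hK, lintegral_eq_zero_iff (by fun_prop)] at h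
    have hfalse : ∀ᵐ t ∂ν, False := by
      filter_upwards [h, hpos] with t h1 h2
      have := hw0 t h2
      simp only [Pi.zero_apply, ENNReal.ofReal_eq_zero] at h1
      exact absurd h1 (not_le.2 (by positivity))
    simp at hfalse
    exact IsProbabilityMeasure.ne_zero ν hfalse
  by_cases hXY : X = ⊤
  · rw [hXY, top_add, ENNReal.mul_top]
    · exact le_top
    · exact fun h => hK0 (le_antisymm ((le_max_right _ _).trans h.le) bot_le)
  · refine (le_ofReal_sInf_mul_add hP ⟨0, fun C hC => hC.1.le⟩ hXY htotal).trans ?_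
    rw [mul_add]
    gcongr
    · exact le_max_left _ _
    · exact le_max_right _ _

end Liouville

theorem mainTheorem1 (n : ℕ) (hn : 1 ≤ n)
    (α : Fin n → ℝ) (hα : ∀ i, 0 < α i)
    (g : ℝ → ℝ) (hg_meas : Measurable g) (hg_pos : ∀ s, 0 < s → 0 < g s)
    (μ : Measure (Fin n → ℝ)) (hμ_prob : IsProbabilityMeasure μ) (hμ : μ = liouvilleLaw α g)
    (w : ℝ → ℝ) (hw_meas : Measurable w) (hw_pos : ∀ s, 0 < s → 0 < w s)
    (hP : ∃ C : ℝ, WeightedPoincare (radialLaw α g) w C)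
    (K : ℝ≥0∞) (hK : K = ∫⁻ s, ENNReal.ofReal (s ^ 2 / w s) ∂(radialLaw α g))
    (f : (Fin n → ℝ) → ℝ) (hf : MemLp f 2 μ)
    (d : Fin n → (Fin n → ℝ) → ℝ)
    (hd : ∀ i, HasWeakDirDeriv (posOrthant n) f (Pi.single i 1) (d i)) :
    ENNReal.ofReal ((∫ x, f x ^ 2 ∂μ) - (∫ x, f x ∂μ) ^ 2) ≤
      max (ENNReal.ofReal (poincareConst (radialLaw α g) w)) (K / ENNReal.ofReal (∑ i, α i)) *
        ∫⁻ x, ENNReal.ofReal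
          (w (∑ i, x i) / (∑ i, x i) * ∑ i, x i * d i x ^ 2) ∂μ := by
  subst hμ hK
  -- Local integrability gives `f` and the `d i` measurable representatives; replacing them changes
  -- neither the weak derivatives nor any of the integrals.
  have hfa : AEStronglyMeasurable f (volume.restrict (posOrthant n)) :=
    (hd ⟨0, hn⟩).1.aestronglyMeasurable
  have hda : ∀ i, AEStronglyMeasurable (d i) (volume.restrict (posOrthant n)) := fun i =>
    (hd i).2.1.aestronglyMeasurable
  have hac : liouvilleLaw α g ≪ volume.restrict (posOrthant n) := lawPropTo_absolutelyContinuous _ _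
  have hfe := hac.ae_le hfa.ae_eq_mk
  have hde := fun i => hac.ae_le (hda i).ae_eq_mk
  have key := evariance_liouvilleLaw_le_of_measurable hn hα hg_meas hμ_prob hw_meas hw_pos hP
    hfa.stronglyMeasurable_mk.measurable (hf.ae_eq hfe)
    (fun i => (hda i).stronglyMeasurable_mk.measurable)
    fun i => (hd i).congr_ae hfa.ae_eq_mk (hda i).ae_eq_mk
  rw [← evariance_eq_ofReal_sub hf, ProbabilityTheory.evariance_congr hfe]
  refine key.trans (le_of_eq ?_)
  congr 1
  refine lintegral_congr_ae ?_
  filter_upwards [ae_all_iff.2 hde] with x hx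
  simp only [hx]
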